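/- **Definitions.** Let $G$ be a graph with vertex set $V=\{0,\dots,n-1\}$ and maximum degree $\Delta$, and let $\lambda\ge 0$. The *hardcore distribution* $\mu_{G,\lambda}$ on labellings $V\to\{0,1\}$ gives the indicator of an independent set $I$ probability proportional to $\lambda^{|I|}$, and every other labelling probability $0$. It is the pairwise Markov random field with vertex constraints $b_v(0)=1$, $b_v(1)=\lambda$ and edge constraints $A_e(x,y)=0$ if $x=y=1$ and $A_e(x,y)=1$ otherwise. One transition, with activity parameter $p\in(0,1]$, of the *distributed Metropolis–Hastings chain* of a pairwise Markov random field with current labelling $X$ is as follows. Independently, every vertex $v$ becomes active with probability $p$, and if active draws a proposal $\sigma_v$ from the distribution proportional to $b_v$. Then, independently, every edge $e=\{u,v\}$ is accepted with probability $$\frac{A_e(X_u,\sigma_v)}{\max A_e}\cdot\frac{A_e(\sigma_u,X_v)}{\max A_e}\cdot\frac{A_e(\sigma_u,\sigma_v)}{\max A_e},$$ where a factor that involves the proposal of an inactive vertex is $1$. Finally every active vertex $v$ all of whose incident edges are accepted sets $X_v\leftarrow\sigma_v$; all other vertices keep their labels. In the *CongestedClique* with $B$-bit messages there is one machine for each vertex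 $v\in V$. It initially knows its identifier, its set of neighbours in $G$, and its own private randomness, independent of that of the other machines. In each synchronous round every machine sends a message of $B$ bits to every other machine; local computation is unbounded. The parameters $n,\lambda,\delta,p$ are known to all machines. **Theorem.** For every $\alpha\in[0,1)$ there are $p\in(0,1]$, $C$ and $k$, depending only on $\alpha$, such that for all $n\ge 2$, $\lambda\ge 0$ and $\delta\in(0,1)$ there are a number $B\le C\log n$ of bits per message, a number $T\le C\log\frac n\delta$ of transitions, a number $R$ of rounds with $1\le R\le C\left(\log\frac n\delta\right)^k$, and a randomized CongestedClique algorithm with $B$-bit messages for which the following holds on every graph $G$ on $n$ vertices with $\Delta\ge 2$ and $\lambda\le\frac{\alpha}{\Delta-1}$. 1. The law of the distributed Metropolis–Hastings chain of the hardcore model with activity parameter $p$, after $T$ transitions from the empty independent set, is within total variation distance $\delta$ of $\mu_{G,\lambda}$. 2. There are labellings $S_1,\dots,S_n$, determined by the machines' randomness, that are independent and each distributed exactly as that chain after $T$ transitions from the empty independent set, such that after $R$ rounds every machine $v$ has either produced no output or output exactly its labels $(S_1(v),\dots,S_n(v))$ in all $n$ samples; and with probability at least $1-\frac1{n^2}$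 every machine has produced its output after $R$ rounds. In particular, for $\delta=1/\mathrm{poly}(n)$, $n$ samples are drawn in $\tilde O(1)$ rounds with probability at least $1-\frac1{n^2}$, while every machine sends and receives at most $nR=\tilde O(n)$ messages of $O(\log n)$ bits. -/

import Mathlib

open scoped NNReal ENNReal

noncomputable section

/-! ### Finite probability -/

/-- A biased coin: `true` with probability `p`. -/
def coin (p : ℝ≥0) (hp : p ≤ 1) : PMF Bool :=
  PMF.ofFintype (fun b => ((if b then p else 1 - p : ℝ≥0) : ℝ≥0∞)) (by
    simp only [Fintype.sum_bool, if_true, Bool.false_eq_true, if_false]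
    rw [← ENNReal.coe_add, add_tsub_cancel_of_le hp, ENNReal.coe_one])

/-- The law on a finite type that is proportional to a weight `w`, not identically zero. -/
def weighted {A : Type} [Fintype A] (w : A → ℝ≥0) (hw : ∃ a, w a ≠ 0) : PMF A :=
  PMF.ofFintype (fun a => ((w a / ∑ b, w b : ℝ≥0) : ℝ≥0∞)) (by
    have h : ∑ b, w b ≠ 0 := by
      obtain ⟨a, ha⟩ := hw
      exact fun h0 => ha ((Finset.sum_eq_zero_iff.mp h0) a (Finset.mem_univ a))
    rw [← ENNReal.ofNNReal_finsetSum, ← Finset.sum_div, div_self h, ENNReal.coe_one])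

/-- The joint law of finitely many independent random variables with laws `q i`. -/
def indep {ι : Type} [Fintype ι] [DecidableEq ι] {α : ι → Type} [∀ i, Fintype (α i)]
    (q : ∀ i, PMF (α i)) : PMF (∀ i, α i) :=
  PMF.ofFintype (fun f => ∏ i, q i (f i)) (by
    have h : ∀ i, ∑ a, q i a = 1 := fun i => by
      rw [← tsum_fintype (L := SummationFilter.unconditional _)]; exact (q i).tsum_coe
    rw [← Fintype.prod_sum]
    simp [h])

/-- Total variation distance between two laws on a finite type. -/
def tvDist {α : Type} [Fintype α] (μ ν : PMF α) : ℝ :=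
  (∑ a, |(μ a).toReal - (ν a).toReal|) / 2

/-! ### Pairwise Markov random fields and the distributed Metropolis-Hastings chain -/

/-- The constraints of a pairwise Markov random field on vertex set `V` with alphabet `A`.
`edgeWeight u v x y` is the constraint of the edge `{u, v}` when `u` is labelled `x` and `v` is
labelled `y`; only its values at edges of the graph are ever used. -/
structure PairwiseMRF (V A : Type) where
  vertexWeight : V → A → ℝ≥0
  edgeWeight : V → V → A → A → ℝ≥0
  edgeWeight_symm : ∀ u v x y, edgeWeight u v x y = edgeWeight v u y x
  vertexWeight_ne_zero : ∀ v, ∃ a, vertexWeight v a ≠ 0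
  edgeWeight_ne_zero : ∀ u v, ∃ x y, edgeWeight u v x y ≠ 0

namespace PairwiseMRF

variable {V A : Type} [Fintype A] (M : PairwiseMRF V A)

/-- The maximum of the constraint of the edge `{u, v}`. -/
def maxWeight (u v : V) : ℝ≥0 :=
  Finset.univ.sup fun xy : A × A => M.edgeWeight u v xy.1 xy.2

/-- The factor `A_e(x, y) / max A_e`, and `1` if one of the two labels is missing because the
vertex is inactive. -/
def ratio (u v : V) : Option A → Option A → ℝ≥0
  | some x, some y => M.edgeWeight u v x y / M.maxWeight u v
  | _, _ => 1

theorem maxWeight_comm (u v : V) : M.maxWeight u v = M.maxWeight v u := by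
  have h : ∀ u v, M.maxWeight u v ≤ M.maxWeight v u := fun u v =>
    Finset.sup_le fun xy _ => by
      rw [M.edgeWeight_symm]
      exact Finset.le_sup (f := fun xy : A × A => M.edgeWeight v u xy.1 xy.2)
        (Finset.mem_univ (xy.2, xy.1))
  exact le_antisymm (h u v) (h v u)

theorem ratio_comm (u v : V) (x y : Option A) : M.ratio u v x y = M.ratio v u y x := by
  cases x <;> cases y <;> simp [ratio, M.maxWeight_comm u v, M.edgeWeight_symm u v]

theorem ratio_le_one (u v : V) (x y : Option A) : M.ratio u v x y ≤ 1 := by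
  cases x <;> cases y <;> simp only [ratio, le_refl]
  next a b =>
    exact div_le_one_of_le₀ (Finset.le_sup
      (f := fun xy : A × A => M.edgeWeight u v xy.1 xy.2) (Finset.mem_univ (a, b))) zero_le

/-- The probability with which the edge `e` is accepted, when the current labelling is `X` and the
proposals are `σ` (`none` at an inactive vertex). -/
def acceptProb (X : V → A) (σ : V → Option A) (e : Sym2 V) : ℝ≥0 :=
  Sym2.lift ⟨fun u v =>
    M.ratio u v (some (X u)) (σ v) * M.ratio u v (σ u) (some (X v)) * M.ratio u v (σ u) (σ v),
    fun u v => by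
      dsimp only
      rw [M.ratio_comm u v, M.ratio_comm u v (σ u) (some (X v)), M.ratio_comm u v (σ u) (σ v),
        mul_comm (M.ratio v u (σ v) (some (X u)))]⟩ e

theorem acceptProb_le_one (X : V → A) (σ : V → Option A) (e : Sym2 V) :
    M.acceptProb X σ e ≤ 1 := by
  induction e with
  | _ u v =>
    exact mul_le_one' (mul_le_one' (M.ratio_le_one _ _ _ _) (M.ratio_le_one _ _ _ _))
      (M.ratio_le_one _ _ _ _)

/-- The proposal of the vertex `v`: with probability `p` it is active and proposes a label drawn
proportionally to its vertex constraint, otherwise it is inactive. -/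
def proposal (p : ℝ≥0) (hp : p ≤ 1) (v : V) : PMF (Option A) :=
  (coin p hp).bind fun active =>
    if active then (weighted (M.vertexWeight v) (M.vertexWeight_ne_zero v)).map some
    else PMF.pure none

variable [Fintype V] [DecidableEq V] (G : SimpleGraph V) [DecidableRel G.Adj]

/-- One transition of the distributed Metropolis-Hastings chain from the labelling `X`. -/
def step (p : ℝ≥0) (hp : p ≤ 1) (X : V → A) : PMF (V → A) :=
  (indep fun v => M.proposal p hp v).bind fun σ =>
    (indep fun e : G.edgeSet =>
        coin (M.acceptProb X σ e) (M.acceptProb_le_one X σ e)).map fun accepted v =>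
      match σ v with
      | some a => if ∀ e : G.edgeSet, v ∈ (e : Sym2 V) → accepted e = true then a else X v
      | none => X v

/-- The law of the distributed Metropolis-Hastings chain after `t` transitions from `X`. -/
def law (p : ℝ≥0) (hp : p ≤ 1) (X : V → A) : ℕ → PMF (V → A)
  | 0 => PMF.pure X
  | t + 1 => (law p hp X t).bind (M.step G p hp)

end PairwiseMRF

/-! ### The hardcore model -/

/-- The hardcore model with fugacity `fug` as a pairwise Markov random field with labels
`false` (that is `0`) and `true` (that is `1`). -/
def hardcoreMRF (V : Type) (fug : ℝ≥0) : PairwiseMRF V Bool where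
  vertexWeight _ x := if x then fug else 1
  edgeWeight _ _ x y := if x = true ∧ y = true then 0 else 1
  edgeWeight_symm _ _ x y := by simp only [and_comm]
  vertexWeight_ne_zero _ := ⟨false, by simp⟩
  edgeWeight_ne_zero _ _ := ⟨false, false, by simp⟩

open Classical in
/-- The hardcore distribution: the indicator function of an independent set `I` has probability
proportional to `fug ^ |I|`, and every other labelling has probability `0`. -/
def hardcore {V : Type} [Fintype V] (G : SimpleGraph V) (fug : ℝ≥0) : PMF (V → Bool) :=
  weighted
    (fun l => if G.IsIndepSet {v | l v = true} then
      fug ^ (Finset.univ.filter fun v => l v = true).card else 0)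
    ⟨fun _ => false, by simp [SimpleGraph.IsIndepSet]⟩

/-! ### The CongestedClique model -/

/-- A randomized algorithm for `n` machines in the CongestedClique with messages of `B` bits.
Machine `v` has the identifier `v : Fin n`, and starts knowing its set of neighbours in the input
graph and its own private randomness. In every synchronous round it sends one message of `B` bits
to each machine, and computes its next state from its state and the messages that it received
(the message that comes from itself tells it nothing new). Local computation is unbounded.
`output` is `none` as long as a machine has no output. -/
structure CongestedCliqueAlg (n B : ℕ) (Out : Type) where
  Coins : Type
  [fintypeCoins : Fintype Coins]
  coinLaw : PMF Coins
  State : Type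
  init : (v : Fin n) → (nbrs : Set (Fin n)) → Coins → State
  send : (v : Fin n) → State → (receiver : Fin n) → (Fin B → Bool)
  receive : (v : Fin n) → State → (inbox : (sender : Fin n) → (Fin B → Bool)) → State
  output : (v : Fin n) → State → Option Out

namespace CongestedCliqueAlg

attribute [instance] fintypeCoins

variable {n B : ℕ} {Out : Type} (P : CongestedCliqueAlg n B Out)

/-- The joint law of the private, independent randomness of all machines. -/
def randomness : PMF (Fin n → P.Coins) :=
  indep fun _ => P.coinLaw

/-- The state of every machine after `r` rounds on the input graph `G`, with private randomness
`ω`. -/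
def stateAfter (G : SimpleGraph (Fin n)) (ω : Fin n → P.Coins) : ℕ → Fin n → P.State
  | 0 => fun v => P.init v (G.neighborSet v) (ω v)
  | r + 1 => fun v => P.receive v (stateAfter G ω r v) fun u => P.send u (stateAfter G ω r u) v

/-- The output, if any, of machine `v` after `r` rounds. -/
def outputAfter (G : SimpleGraph (Fin n)) (ω : Fin n → P.Coins) (r : ℕ) (v : Fin n) : Option Out :=
  P.output v (P.stateAfter G ω r v)

end CongestedCliqueAlg

end

/-! Sampling. For the hardcore model every edge is accepted with probability 0 or 1, so a transition
is a deterministic map `update` of the labelling and the proposals (`hardcore_step`). On independent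
labellings, swapping label and proposal at the accepted vertices is a weight-preserving involution
of pairs (labelling, proposals), so the hardcore law is stationary (`expect_hardcore_update`).
Mixing is path coupling with shared proposals: if two independent sets differ only at `v`, the
difference at `v` survives unless `v` is active and no neighbour proposes `true`, and it spreads
only to neighbours that propose `true`. With b = fug/(fug+1), the bound Δb ≤ 2α/(1+α) < 1 makes the
expected distance at most 1 - p² for p = (1 - 2α/(1+α))/2. Dually, a transition multiplies Lipschitz
constants by 1 - p², and T of order log(n/δ) suffices.

Communication. Each machine draws its proposals for all n samples at the start, so the samples are
functions of the private coins and have exactly the right joint law, whatever happens to the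
messages. In each transition the data of sample `i` for receiver `v` goes through relay `i + v`. A
machine has something to report in a sample only if it proposes `true` there at some time. For any
link this concerns at most Δ independent (machine, sample) pairs with expected number at most T,
since Δb ≤ 1. An exponential moment and a union bound over the 2n² loads give K = O(T + log n)
nonzero entries per message, simultaneously for the whole run, with probability 1 - 1/n²
(`expect_lt_load_le`, `le_toReal_of_load`).

Such sparse messages are sent bit by bit, so B = 1. An oversized message is replaced by an abort
symbol that makes its receivers abort; hence any output is correct (`Protocol.simulated_sound`), and
under the load bound nobody aborts (`Protocol.simulated_complete`). -/

noncomputable section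

/-! ### Expectations over finite types -/

/-- The expectation of `f` under a law on a finite type. -/
def expect {α : Type} [Fintype α] (μ : PMF α) (f : α → ℝ) : ℝ :=
  ∑ a, (μ a).toReal * f a

section Expect

variable {α β : Type} [Fintype α] [Fintype β]

theorem sum_toReal_eq_one (μ : PMF α) : ∑ a, (μ a).toReal = 1 := by
  rw [← ENNReal.toReal_sum fun a _ => μ.apply_ne_top a,
    ← tsum_fintype (L := SummationFilter.unconditional _), μ.tsum_coe, ENNReal.toReal_one]

theorem expect_const (μ : PMF α) (c : ℝ) : expect μ (fun _ => c) = c := by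
  rw [expect, ← Finset.sum_mul, sum_toReal_eq_one, one_mul]

theorem expect_mono (μ : PMF α) {f g : α → ℝ} (h : ∀ a, f a ≤ g a) : expect μ f ≤ expect μ g :=
  Finset.sum_le_sum fun a _ => mul_le_mul_of_nonneg_left (h a) ENNReal.toReal_nonneg

theorem expect_add (μ : PMF α) (f g : α → ℝ) :
    expect μ (fun a => f a + g a) = expect μ f + expect μ g := by
  simp only [expect, mul_add, Finset.sum_add_distrib]

theorem expect_sub (μ : PMF α) (f g : α → ℝ) :
    expect μ (fun a => f a - g a) = expect μ f - expect μ g := by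
  simp only [expect, mul_sub, Finset.sum_sub_distrib]

theorem expect_const_mul (μ : PMF α) (c : ℝ) (f : α → ℝ) :
    expect μ (fun a => c * f a) = c * expect μ f := by
  simp only [expect, Finset.mul_sum, mul_left_comm]

theorem expect_sum (μ : PMF α) {ι : Type} (s : Finset ι) (f : ι → α → ℝ) :
    expect μ (fun a => ∑ i ∈ s, f i a) = ∑ i ∈ s, expect μ (f i) := by
  simp only [expect, Finset.mul_sum]
  exact Finset.sum_comm

theorem abs_expect_le (μ : PMF α) (f : α → ℝ) : |expect μ f| ≤ expect μ (fun a => |f a|) := by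
  refine (Finset.abs_sum_le_sum_abs _ _).trans_eq (Finset.sum_congr rfl fun a _ => ?_)
  rw [abs_mul, abs_of_nonneg ENNReal.toReal_nonneg]

theorem expect_pure (a : α) (f : α → ℝ) : expect (PMF.pure a) f = f a := by
  classical
  rw [expect, Finset.sum_eq_single a] <;> simp +contextual [PMF.pure_apply]

theorem expect_bind (μ : PMF α) (k : α → PMF β) (f : β → ℝ) :
    expect (μ.bind k) f = expect μ fun a => expect (k a) f := by
  simp only [expect, PMF.bind_apply, Finset.mul_sum]
  rw [Finset.sum_comm]
  refine Finset.sum_congr rfl fun b _ => ?_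
  rw [tsum_fintype, ENNReal.toReal_sum, Finset.sum_mul]
  · exact Finset.sum_congr rfl fun a _ => by rw [ENNReal.toReal_mul, mul_assoc]
  · exact fun a _ => ENNReal.mul_ne_top (μ.apply_ne_top a) ((k a).apply_ne_top b)

theorem expect_map (μ : PMF α) (g : α → β) (f : β → ℝ) :
    expect (μ.map g) f = expect μ fun a => f (g a) := by
  rw [PMF.map, expect_bind]
  exact congrArg _ (funext fun a => expect_pure _ f)

theorem ext_of_expect {μ ν : PMF α} (h : ∀ f, expect μ f = expect ν f) : μ = ν := by
  classical
  ext a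
  have := h (Pi.single a 1)
  simp only [expect, Pi.single_apply, mul_ite, mul_one, mul_zero, Finset.sum_ite_eq',
    Finset.mem_univ, if_true] at this
  exact (ENNReal.toReal_eq_toReal_iff' (μ.apply_ne_top a) (ν.apply_ne_top a)).mp this

open Classical in
theorem toReal_toOuterMeasure (μ : PMF α) (s : Set α) :
    (μ.toOuterMeasure s).toReal = expect μ fun a => if a ∈ s then 1 else 0 := by
  rw [PMF.toOuterMeasure_apply_fintype, expect, ENNReal.toReal_sum]
  · refine Finset.sum_congr rfl fun a _ => ?_
    by_cases h : a ∈ s <;> simp [h]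
  · intro a _
    by_cases h : a ∈ s <;> simp [h, μ.apply_ne_top a]

theorem expect_coin (p : ℝ≥0) (hp : p ≤ 1) (f : Bool → ℝ) :
    expect (coin p hp) f = p * f true + (1 - p) * f false := by
  simp [expect, coin, PMF.ofFintype_apply, NNReal.coe_sub hp]

theorem expect_weighted (w : α → ℝ≥0) (hw : ∃ a, w a ≠ 0) (f : α → ℝ) :
    expect (weighted w hw) f = (∑ a, (w a : ℝ) * f a) / ∑ a, (w a : ℝ) := by
  rw [expect, Finset.sum_div]
  refine Finset.sum_congr rfl fun a _ => ?_
  simp only [weighted, PMF.ofFintype_apply, ENNReal.coe_toReal, NNReal.coe_div, NNReal.coe_sum]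
  ring

end Expect

section Indep

variable {ι : Type} [Fintype ι] [DecidableEq ι] {α β : ι → Type} [∀ i, Fintype (α i)]
  [∀ i, Fintype (β i)]

theorem indep_toReal (q : ∀ i, PMF (α i)) (f : ∀ i, α i) :
    (indep q f).toReal = ∏ i, (q i (f i)).toReal := by
  simp only [indep, PMF.ofFintype_apply, ENNReal.toReal_prod]

theorem expect_indep_prod (q : ∀ i, PMF (α i)) (g : ∀ i, α i → ℝ) :
    expect (indep q) (fun x => ∏ i, g i (x i)) = ∏ i, expect (q i) (g i) := by
  simp only [expect, indep_toReal, ← Finset.prod_mul_distrib]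
  rw [Fintype.prod_sum]

theorem expect_indep_eval (q : ∀ i, PMF (α i)) (i : ι) (h : α i → ℝ) :
    expect (indep q) (fun x => h (x i)) = expect (q i) h := by
  have := expect_indep_prod q
    (fun j => if e : j = i then fun a => h (e ▸ a) else fun _ => 1)
  rw [Finset.prod_eq_single i (fun j _ hj => by simp [hj, expect_const]) (by simp)] at this
  simp only [dite_true] at this
  rw [← this]
  congr 1
  funext x
  rw [Finset.prod_eq_single i (fun j _ hj => by simp [hj]) (by simp)]
  simp

/-- Point indicators are products of coordinate indicators and span all functions, so it is enough
to test on products, where expectations factorize. -/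
theorem indep_map (q : ∀ i, PMF (α i)) (g : ∀ i, α i → β i) :
    indep (fun i => (q i).map (g i)) = (indep q).map fun x i => g i (x i) := by
  classical
  refine ext_of_expect fun f => ?_
  have hf : f = fun y => ∑ z, f z * ∏ i, (Pi.single (z i) (1 : ℝ) : β i → ℝ) (y i) := by
    funext y
    rw [Finset.sum_eq_single y]
    · simp
    · intro z _ hz
      obtain ⟨i, hi⟩ := Function.ne_iff.mp hz
      rw [Finset.prod_eq_zero (Finset.mem_univ i) (by simp [hi.symm]), mul_zero]
    · simp
  rw [hf, expect_map, expect_sum, expect_sum]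
  refine Finset.sum_congr rfl fun z _ => ?_
  rw [expect_const_mul, expect_const_mul, expect_indep_prod]
  rw [expect_indep_prod q (fun i a => (Pi.single (z i) (1 : ℝ) : β i → ℝ) (g i a))]
  simp only [expect_map]

theorem indep_pure (a : ∀ i, α i) : indep (fun i => PMF.pure (a i)) = PMF.pure a := by
  have := indep_map (fun _ : ι => PMF.pure ()) (fun i _ => a i)
  simp only [PMF.pure_map] at this
  rw [this]
  refine ext_of_expect fun f => ?_
  rw [expect_map, expect_const, expect_pure]

end Indep

/-! ### The hardcore chain as a random map -/

/-- The law of the proposal of a vertex in the hardcore chain. -/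
def hardcoreProposal (p : ℝ≥0) (hp : p ≤ 1) (fug : ℝ≥0) : PMF (Option Bool) :=
  (hardcoreMRF Unit fug).proposal p hp ()

theorem expect_hardcoreProposal (p : ℝ≥0) (hp : p ≤ 1) (fug : ℝ≥0) (f : Option Bool → ℝ) :
    expect (hardcoreProposal p hp fug) f =
      p * ((fug * f (some true) + f (some false)) / (fug + 1)) + (1 - p) * f none := by
  rw [hardcoreProposal, PairwiseMRF.proposal, expect_bind, expect_coin]
  simp [expect_map, expect_pure, expect_weighted, hardcoreMRF]

/-- The factor besides the vertex weight does not depend on the proposed label, so exchanging label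
and proposal at an active vertex preserves the product of their weights. -/
theorem toReal_hardcoreProposal_some (p : ℝ≥0) (hp : p ≤ 1) (fug : ℝ≥0) (a : Bool) :
    (hardcoreProposal p hp fug (some a)).toReal =
      p / (fug + 1) * (if a then (fug : ℝ) else 1) := by
  have h := expect_hardcoreProposal p hp fug (Pi.single (some a) 1)
  rw [expect, Finset.sum_eq_single (some a) (by simp +contextual) (by simp)] at h
  simp only [Pi.single_eq_same, mul_one] at h
  rw [h]
  cases a <;> simp <;> ring

section Step

variable {V : Type}

/-- The edge `{u, v}` is accepted for the labelling `X` and the proposals `σ`. -/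
def EdgeOk (X : V → Bool) (σ : V → Option Bool) (u v : V) : Prop :=
  ¬(X u = true ∧ σ v = some true) ∧ ¬(σ u = some true ∧ X v = true) ∧
    ¬(σ u = some true ∧ σ v = some true)

/-- The vertex `v` is active and all its edges are accepted. -/
def Accepted (G : SimpleGraph V) (X : V → Bool) (σ : V → Option Bool) (v : V) : Prop :=
  (σ v).isSome = true ∧ ∀ u, G.Adj v u → EdgeOk X σ v u

open Classical in
/-- The labelling after a transition from `X` with proposals `σ`. -/
def update (G : SimpleGraph V) (X : V → Bool) (σ : V → Option Bool) (v : V) : Bool :=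
  if Accepted G X σ v then (σ v).getD false else X v

theorem EdgeOk.symm {X : V → Bool} {σ : V → Option Bool} {u v : V} (h : EdgeOk X σ u v) :
    EdgeOk X σ v u := by
  unfold EdgeOk at *
  tauto

theorem hardcore_acceptProb (fug : ℝ≥0) (X : V → Bool) (σ : V → Option Bool) (u v : V)
    [Decidable (EdgeOk X σ u v)] :
    (hardcoreMRF V fug).acceptProb X σ s(u, v) = if EdgeOk X σ u v then 1 else 0 := by
  have hm : (hardcoreMRF V fug).maxWeight u v = 1 := by
    refine le_antisymm (Finset.sup_le fun xy _ => ?_) ?_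
    · simp only [hardcoreMRF]
      split_ifs <;> simp
    · exact Finset.le_sup_of_le (Finset.mem_univ (false, false)) (by simp [hardcoreMRF])
  simp only [PairwiseMRF.acceptProb, Sym2.lift_mk]
  split_ifs with h <;> unfold EdgeOk at h <;> revert h <;>
    generalize σ u = s, σ v = t, X u = x, X v = y <;>
    rcases s with _ | _ | _ <;> rcases t with _ | _ | _ <;> cases x <;> cases y <;>
    simp [PairwiseMRF.ratio, hm] <;> simp [hardcoreMRF]

variable [Fintype V] [DecidableEq V]

/-- The acceptance coins have bias 0 or 1, so all randomness of a transition lies in the proposals.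
-/
theorem hardcore_step (G : SimpleGraph V) [DecidableRel G.Adj] (p : ℝ≥0) (hp : p ≤ 1)
    (fug : ℝ≥0) (X : V → Bool) :
    (hardcoreMRF V fug).step G p hp X =
      (indep fun _ : V => hardcoreProposal p hp fug).map (update G X) := by
  classical
  rw [PairwiseMRF.step, PMF.map]
  congr 1
  funext σ
  have hc : ∀ e : G.edgeSet, coin ((hardcoreMRF V fug).acceptProb X σ e)
      ((hardcoreMRF V fug).acceptProb_le_one X σ e) =
      PMF.pure (decide ((hardcoreMRF V fug).acceptProb X σ e = 1)) := by
    rintro ⟨e, he⟩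
    induction e with
    | _ u v =>
      refine ext_of_expect fun f => ?_
      rw [expect_coin, expect_pure]
      simp only [hardcore_acceptProb]
      by_cases h : EdgeOk X σ u v <;> simp [h]
  simp only [hc, indep_pure, PMF.pure_map, Function.comp]
  congr 1
  funext v
  have key : (∀ e : G.edgeSet, v ∈ (e : Sym2 V) →
      decide ((hardcoreMRF V fug).acceptProb X σ e = 1) = true) ↔
      ∀ u, G.Adj v u → EdgeOk X σ v u := by
    constructor
    · intro h u hu
      have := h ⟨s(v, u), hu⟩ (by simp)
      by_contra hn
      simp [hardcore_acceptProb, hn] at this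
    · rintro h ⟨e, he⟩ hv
      obtain ⟨u, rfl⟩ := hv
      simp [hardcore_acceptProb, h u he]
  rcases hs : σ v with _ | a
  · simp [update, Accepted, hs]
  · simp only [key]
    simp [update, Accepted, hs]

end Step

/-! ### Stationarity -/

section Stationary

variable {V : Type} {G : SimpleGraph V} {X : V → Bool} {σ : V → Option Bool}

/-- The set of vertices with label `true` is independent. -/
def IsIndep (G : SimpleGraph V) (X : V → Bool) : Prop :=
  ∀ u v, G.Adj u v → ¬(X u = true ∧ X v = true)

theorem isIndepSet_iff_isIndep : G.IsIndepSet {v | X v = true} ↔ IsIndep G X := by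
  constructor
  · rintro h u v huv ⟨hu, hv⟩
    exact h hu hv huv.ne huv
  · intro h u hu v hv _ huv
    exact h u v huv ⟨hu, hv⟩

open Classical in
/-- The proposals that revert a transition. -/
def revert (G : SimpleGraph V) (X : V → Bool) (σ : V → Option Bool) (v : V) : Option Bool :=
  if Accepted G X σ v then some (X v) else σ v

theorem update_of_accepted {v : V} (h : Accepted G X σ v) : σ v = some (update G X σ v) := by
  obtain ⟨a, ha⟩ := Option.isSome_iff_exists.mp h.1
  simp [update, h, ha]

theorem update_of_not_accepted {v : V} (h : ¬Accepted G X σ v) : update G X σ v = X v := by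
  simp [update, h]

theorem revert_of_accepted {v : V} (h : Accepted G X σ v) : revert G X σ v = some (X v) := by
  simp [revert, h]

theorem revert_of_not_accepted {v : V} (h : ¬Accepted G X σ v) : revert G X σ v = σ v := by
  simp [revert, h]

theorem IsIndep.update (hX : IsIndep G X) (σ : V → Option Bool) :
    IsIndep G (update G X σ) := by
  intro u v huv
  have h0 := hX u v huv
  by_cases hu : Accepted G X σ u <;> by_cases hv : Accepted G X σ v
  · have h := hu.2 v huv
    simp only [EdgeOk, update_of_accepted hu, update_of_accepted hv, Option.some_inj] at h
    exact h.2.2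
  · have h := hu.2 v huv
    simp only [EdgeOk, update_of_accepted hu, Option.some_inj] at h
    rw [update_of_not_accepted hv]
    exact h.2.1
  · have h := hv.2 u huv.symm
    simp only [EdgeOk, update_of_accepted hv, Option.some_inj] at h
    rw [update_of_not_accepted hu]
    tauto
  · rwa [update_of_not_accepted hu, update_of_not_accepted hv]

/-- If an endpoint is accepted, no label or proposal of `u` conflicts with one of `v`: independence
excludes the label-label conflict, `EdgeOk` the other three. This survives swapping label and
proposal at either end. If neither is accepted, nothing changes. -/
theorem edgeOk_revert (hX : IsIndep G X) {u v : V} (huv : G.Adj u v) :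
    EdgeOk (update G X σ) (revert G X σ) u v ↔ EdgeOk X σ u v := by
  have h0 := hX u v huv
  by_cases hu : Accepted G X σ u <;> by_cases hv : Accepted G X σ v
  · have h := hu.2 v huv
    have hu' := update_of_accepted hu
    have hv' := update_of_accepted hv
    simp only [EdgeOk, revert_of_accepted hu, revert_of_accepted hv, hu', hv',
      Option.some_inj] at h ⊢
    tauto
  · have h := hu.2 v huv
    have hu' := update_of_accepted hu
    simp only [EdgeOk, revert_of_accepted hu, revert_of_not_accepted hv, hu',
      update_of_not_accepted hv, Option.some_inj] at h ⊢
    tauto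
  · have h := (hv.2 u huv.symm).symm
    have hv' := update_of_accepted hv
    simp only [EdgeOk, revert_of_accepted hv, revert_of_not_accepted hu, hv',
      update_of_not_accepted hu, Option.some_inj] at h ⊢
    tauto
  · simp only [EdgeOk, revert_of_not_accepted hu, revert_of_not_accepted hv,
      update_of_not_accepted hu, update_of_not_accepted hv]

theorem accepted_revert (hX : IsIndep G X) {v : V} :
    Accepted G (update G X σ) (revert G X σ) v ↔ Accepted G X σ v := by
  have h1 : (revert G X σ v).isSome = true ↔ (σ v).isSome = true := by
    by_cases hv : Accepted G X σ v
    · simp [revert_of_accepted hv, hv.1]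
    · rw [revert_of_not_accepted hv]
  unfold Accepted
  rw [h1]
  exact and_congr_right fun _ => forall₂_congr fun u hu => edgeOk_revert hX hu

theorem update_revert (hX : IsIndep G X) : update G (update G X σ) (revert G X σ) = X := by
  funext v
  by_cases hv : Accepted G X σ v
  · have := update_of_accepted ((accepted_revert hX).mpr hv)
    rw [revert_of_accepted hv] at this
    exact (Option.some_inj.mp this).symm
  · rw [update_of_not_accepted (mt (accepted_revert hX).mp hv), update_of_not_accepted hv]

theorem revert_revert (hX : IsIndep G X) : revert G (update G X σ) (revert G X σ) = σ := by
  funext v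
  by_cases hv : Accepted G X σ v
  · rw [revert_of_accepted ((accepted_revert hX).mpr hv), ← update_of_accepted hv]
  · rw [revert_of_not_accepted (mt (accepted_revert hX).mp hv), revert_of_not_accepted hv]

variable [Fintype V] [DecidableEq V]

open Classical in
/-- The weight of an independent set in the hardcore model. -/
def hardcoreWeight (G : SimpleGraph V) (fug : ℝ≥0) (X : V → Bool) : ℝ :=
  if IsIndep G X then ∏ v, (if X v then (fug : ℝ) else 1) else 0

theorem expect_hardcore (G : SimpleGraph V) (fug : ℝ≥0) (f : (V → Bool) → ℝ) :
    expect (hardcore G fug) f =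
      (∑ X, hardcoreWeight G fug X * f X) / ∑ X, hardcoreWeight G fug X := by
  -- The `Fintype` instance on labellings inside `hardcore` is built from classical decidable
  -- equality.
  obtain rfl : ‹DecidableEq V› = fun a b => Classical.propDecidable (a = b) :=
    Subsingleton.elim _ _
  classical
  rw [hardcore, expect_weighted]
  have : ∀ X : V → Bool, hardcoreWeight G fug X = _ := fun X => by
    rw [hardcoreWeight, ← isIndepSet_iff_isIndep, Finset.prod_ite, Finset.prod_const,
      Finset.prod_const_one, mul_one]
  simp only [this, apply_ite NNReal.toReal, NNReal.coe_pow, NNReal.coe_zero]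

theorem hardcoreWeight_revert (hX : IsIndep G X) (p : ℝ≥0) (hp : p ≤ 1) (fug : ℝ≥0) :
    hardcoreWeight G fug (update G X σ) *
      (indep (fun _ : V => hardcoreProposal p hp fug) (revert G X σ)).toReal =
    hardcoreWeight G fug X * (indep (fun _ : V => hardcoreProposal p hp fug) σ).toReal := by
  simp only [hardcoreWeight, if_pos hX, if_pos (hX.update σ), indep_toReal,
    ← Finset.prod_mul_distrib]
  refine Finset.prod_congr rfl fun v _ => ?_
  by_cases hv : Accepted G X σ v
  · rw [revert_of_accepted hv, update_of_accepted hv]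
    simp only [toReal_hardcoreProposal_some]
    ring
  · rw [revert_of_not_accepted hv, update_of_not_accepted hv]

theorem expect_hardcore_update (G : SimpleGraph V) (p : ℝ≥0) (hp : p ≤ 1) (fug : ℝ≥0)
    (f : (V → Bool) → ℝ) :
    (expect (hardcore G fug) fun X =>
      expect (indep fun _ : V => hardcoreProposal p hp fug) fun σ => f (update G X σ)) =
    expect (hardcore G fug) f := by
  classical
  rw [expect_hardcore, expect_hardcore]
  congr 1
  set Q := indep fun _ : V => hardcoreProposal p hp fug
  have h1 : ∀ g : (V → Bool) → (V → Option Bool) → ℝ,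
      ∑ X, hardcoreWeight G fug X * expect Q (g X) =
      ∑ z ∈ (Finset.univ : Finset ((V → Bool) × (V → Option Bool))).filter
        (fun z => IsIndep G z.1), hardcoreWeight G fug z.1 * (Q z.2).toReal * g z.1 z.2 := by
    intro g
    rw [Finset.sum_filter, Fintype.sum_prod_type]
    refine Finset.sum_congr rfl fun X _ => ?_
    by_cases hX : IsIndep G X
    · simp only [if_pos hX, expect, Finset.mul_sum, mul_assoc]
    · simp [hX, hardcoreWeight]
  rw [h1 fun X σ => f (update G X σ)]
  have h2 : ∑ X, hardcoreWeight G fug X * f X =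
      ∑ X, hardcoreWeight G fug X * expect Q (fun _ => f X) := by simp only [expect_const]
  rw [h2, h1 fun X _ => f X]
  -- Reindexing by the involution turns `f` of the new labelling into `f` of the old one, at equal
  -- weight.
  refine Finset.sum_nbij' (fun z => (update G z.1 z.2, revert G z.1 z.2))
    (fun z => (update G z.1 z.2, revert G z.1 z.2)) ?_ ?_ ?_ ?_ ?_
  · exact fun z hz => by simpa using IsIndep.update (by simpa using hz) _
  · exact fun z hz => by simpa using IsIndep.update (by simpa using hz) _
  · exact fun z hz => Prod.ext (update_revert (by simpa using hz))
      (revert_revert (by simpa using hz))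
  · exact fun z hz => Prod.ext (update_revert (by simpa using hz))
      (revert_revert (by simpa using hz))
  · exact fun z hz => by
      dsimp only
      rw [hardcoreWeight_revert (by simpa using hz) p hp fug]

end Stationary

/-! ### Contraction and mixing -/

section Mixing

variable {V : Type} {G : SimpleGraph V}

theorem IsIndep.mono {X Y : V → Bool} (hX : IsIndep G X) (h : ∀ v, Y v = true → X v = true) :
    IsIndep G Y :=
  fun u v huv hY => hX u v huv ⟨h u hY.1, h v hY.2⟩

theorem isIndep_empty : IsIndep G fun _ => false := by simp [IsIndep]

variable [DecidableEq V]

theorem IsIndep.remove {X : V → Bool} (hX : IsIndep G X) (v : V) :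
    IsIndep G (Function.update X v false) := by
  refine hX.mono fun w hw => ?_
  by_cases h : w = v
  · simp [h] at hw
  · simpa [h] using hw

variable [Fintype V]

-- The product on the right is the indicator that `v` is active and no neighbour proposes `true`; in
-- that case both copies accept at `v` and agree there. It is written as a product over vertices so
-- that its expectation factorizes.
open Classical in
theorem hammingDist_update_le {X : V → Bool} (hX : IsIndep G X) {v : V} (hv : X v = true)
    (σ : V → Option Bool) :
    (hammingDist (update G X σ) (update G (Function.update X v false) σ) : ℝ) ≤
      (1 - ∏ u, (if u = v then (if (σ u).isSome then 1 else 0)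
        else if G.Adj v u then (if σ u = some true then 0 else 1) else 1)) +
      ∑ w ∈ Finset.univ.filter (G.Adj v), (if σ w = some true then 1 else 0) := by
  set Y := Function.update X v false with hY
  set D : ℝ := ∏ u, (if u = v then (if (σ u).isSome then 1 else 0)
        else if G.Adj v u then (if σ u = some true then 0 else 1) else 1) with hD
  have hD1 : D ≤ 1 := Finset.prod_le_one (fun u _ => by split_ifs <;> simp)
    fun u _ => by split_ifs <;> simp
  have hYv : Y v = false := by simp [hY]
  have hYX : ∀ w, w ≠ v → Y w = X w := fun w hw => by simp [hY, hw]
  have hN : ∀ w, G.Adj v w → X w = false := fun w hw => by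
    have := hX v w hw
    simpa [hv] using this
  have e : (hammingDist (update G X σ) (update G Y σ) : ℝ) =
      ∑ w, if update G X σ w ≠ update G Y σ w then 1 else 0 := by
    rw [hammingDist, Finset.card_filter]
    push_cast
    exact Finset.sum_congr rfl fun w _ => by congr
  have e2 : (1 - D) = ∑ w, if w = v then 1 - D else 0 := by simp
  rw [e, e2, Finset.sum_filter, ← Finset.sum_add_distrib]
  refine Finset.sum_le_sum fun w _ => ?_
  by_cases hwv : w = v
  · subst hwv
    simp only [if_true, SimpleGraph.irrefl, if_false, add_zero]
    by_cases hs : (σ w).isSome = true ∧ ∀ u, G.Adj w u → σ u ≠ some true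
    · have hXa : Accepted G X σ w := by
        refine ⟨hs.1, fun u hu => ⟨fun h => hs.2 u hu h.2, fun h => ?_, fun h => hs.2 u hu h.2⟩⟩
        simp [hN u hu] at h
      have hYa : Accepted G Y σ w := by
        refine ⟨hs.1, fun u hu => ⟨fun h => hs.2 u hu h.2, fun h => ?_, fun h => hs.2 u hu h.2⟩⟩
        simp [hYX u hu.ne', hN u hu] at h
      rw [if_neg (by simp [update, hXa, hYa])]
      linarith
    · have : D = 0 := by
        rw [not_and_or] at hs
        rcases hs with h | h
        · exact Finset.prod_eq_zero (Finset.mem_univ w) (by simp [h])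
        · push Not at h
          obtain ⟨u, hu, hu2⟩ := h
          exact Finset.prod_eq_zero (Finset.mem_univ u) (by simp [hu.ne', hu, hu2])
      rw [this]
      split_ifs <;> norm_num
  · rw [if_neg hwv, zero_add]
    by_cases hadj : G.Adj v w
    · rw [if_pos hadj]
      by_cases hs : σ w = some true
      · rw [if_pos hs]
        split_ifs <;> norm_num
      -- Neighbours of `v` are labelled `false` in both copies and leave this label only by
      -- proposing `true`.
      · have hz : ∀ Z : V → Bool, Z w = false → update G Z σ w = false := fun Z hZ => by
          unfold update
          split_ifs
          · generalize σ w = s at hs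
            rcases s with _ | _ | _ <;> simp_all
          · exact hZ
        rw [hz X (hN w hadj), hz Y ((hYX w hwv).trans (hN w hadj))]
        simp [hs]
    · rw [if_neg hadj, if_neg]
      -- The vertex `v` is not among the neighbours of `w`, so `w` sees the same labels in both
      -- copies.
      have : Accepted G X σ w ↔ Accepted G Y σ w := by
        refine and_congr_right fun _ => forall₂_congr fun u hu => ?_
        have huv : u ≠ v := fun h => hadj (h ▸ hu).symm
        simp only [EdgeOk, hYX w hwv, hYX u huv]
      simp only [update, this, hYX w hwv, ne_eq, not_not]

open Classical in
theorem expect_hammingDist_update_le {X : V → Bool} (hX : IsIndep G X) {v : V}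
    (hv : X v = true) (p : ℝ≥0) (hp : p ≤ 1) (fug : ℝ≥0) :
    (expect (indep fun _ : V => hardcoreProposal p hp fug) fun σ =>
      (hammingDist (update G X σ) (update G (Function.update X v false) σ) : ℝ)) ≤
      1 - p * (1 - p * (fug / (fug + 1))) ^ (Finset.univ.filter (G.Adj v)).card +
        (Finset.univ.filter (G.Adj v)).card * (p * (fug / (fug + 1))) := by
  refine (expect_mono _ (hammingDist_update_le hX hv)).trans_eq ?_
  rw [expect_add, expect_sub, expect_const, expect_sum]
  have hb : (fug : ℝ) + 1 ≠ 0 := by positivity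
  congr 2
  · rw [expect_indep_prod (fun _ : V => hardcoreProposal p hp fug) (fun u a =>
      if u = v then (if a.isSome then 1 else 0)
        else if G.Adj v u then (if a = some true then 0 else 1) else 1)]
    have h1 : ∀ u, expect (hardcoreProposal p hp fug) (fun a =>
        if u = v then (if a.isSome then (1 : ℝ) else 0)
          else if G.Adj v u then (if a = some true then 0 else 1) else 1) =
        (if u = v then (p : ℝ) else 1) *
          (if G.Adj v u then 1 - p * ((fug : ℝ) / (fug + 1)) else 1) := by
      intro u
      by_cases h : u = v
      · subst h
        simp [expect_hardcoreProposal, div_self hb]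
      · by_cases h2 : G.Adj v u
        · simp only [h, h2, if_true, if_false, expect_hardcoreProposal]
          simp
          field_simp
          ring
        · simp [h, h2, expect_const]
    simp only [h1, Finset.prod_mul_distrib, Finset.prod_ite_eq', Finset.mem_univ, if_true]
    rw [Finset.prod_ite, Finset.prod_const, Finset.prod_const_one, mul_one]
  · rw [Finset.sum_congr rfl fun w _ => expect_indep_eval
      (fun _ : V => hardcoreProposal p hp fug) w (fun a => if a = some true then (1 : ℝ) else 0)]
    rw [Finset.sum_const, nsmul_eq_mul]
    simp [expect_hardcoreProposal]

/-- `f` is Lipschitz with constant `L` for the Hamming distance on independent sets. -/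
def IndepLipschitz (G : SimpleGraph V) (L : ℝ) (f : (V → Bool) → ℝ) : Prop :=
  ∀ X Y, IsIndep G X → IsIndep G Y → |f X - f Y| ≤ L * hammingDist X Y

theorem hammingDist_remove {X Y : V → Bool} {v : V} (hX : X v = true) (hY : Y v = false) :
    hammingDist X Y = hammingDist (Function.update X v false) Y + 1 := by
  rw [hammingDist, hammingDist, ← Finset.card_insert_of_notMem (a := v)]
  · congr 1
    ext w
    by_cases h : w = v
    · subst h; simp [hX, hY]
    · simp [h]
  · simp [hY]

/-- The path argument: deleting a point of one set outside the other reduces the distance by one and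
preserves independence, so two independent sets are joined by a shortest path of independent sets.
-/
theorem indepLipschitz_of_remove {L : ℝ} {f : (V → Bool) → ℝ}
    (h : ∀ X v, IsIndep G X → X v = true → |f X - f (Function.update X v false)| ≤ L) :
    IndepLipschitz G L f := by
  have key : ∀ d : ℕ, ∀ X Y, IsIndep G X → IsIndep G Y → hammingDist X Y = d →
      |f X - f Y| ≤ L * d := by
    intro d
    induction d with
    | zero =>
      intro X Y _ _ hd
      rw [hammingDist_eq_zero.mp hd]
      simp
    | succ d ih =>
      have main : ∀ X Y v, IsIndep G X → IsIndep G Y → hammingDist X Y = d + 1 → X v = true →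
          Y v = false → |f X - f Y| ≤ L * (d + 1 : ℕ) := by
        intro X Y v hX hY hd hXv hYv
        have h1 := ih _ Y (hX.remove v) hY (by
          rw [hammingDist_remove hXv hYv] at hd
          omega)
        have h2 := h X v hX hXv
        have h3 := abs_sub_le (f X) (f (Function.update X v false)) (f Y)
        push_cast
        linarith
      intro X Y hX hY hd
      have hne : X ≠ Y := fun e => by simp [e] at hd
      obtain ⟨v, hv⟩ := Function.ne_iff.mp hne
      rcases hXv : X v with _ | _
      · rw [abs_sub_comm]
        exact main Y X v hY hX (by rwa [hammingDist_comm]) (by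
          rcases hYv : Y v <;> simp_all) hXv
      · exact main X Y v hX hY hd hXv (by rcases hYv : Y v <;> simp_all)
  exact fun X Y hX hY => key _ X Y hX hY rfl

theorem IndepLipschitz.step {L ρ : ℝ} {f : (V → Bool) → ℝ} (hf : IndepLipschitz G L f)
    (hL : 0 ≤ L) (p : ℝ≥0) (hp : p ≤ 1) (fug : ℝ≥0)
    (hρ : ∀ X v, IsIndep G X → X v = true →
      (expect (indep fun _ : V => hardcoreProposal p hp fug) fun σ =>
      (hammingDist (update G X σ) (update G (Function.update X v false) σ) : ℝ)) ≤ ρ) :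
    IndepLipschitz G (L * ρ) fun X =>
      expect (indep fun _ : V => hardcoreProposal p hp fug) fun σ => f (update G X σ) := by
  refine indepLipschitz_of_remove fun X v hX hv => ?_
  rw [← expect_sub]
  refine (abs_expect_le _ _).trans ?_
  refine (expect_mono _ fun σ => hf _ _ (hX.update σ) ((hX.remove v).update σ)).trans ?_
  rw [expect_const_mul]
  exact mul_le_mul_of_nonneg_left (hρ X v hX hv) hL

open Classical in
theorem abs_expect_hardcore_sub_le (fug : ℝ≥0) (f : (V → Bool) → ℝ) (c B : ℝ)
    (h : ∀ X, IsIndep G X → |c - f X| ≤ B) : |c - expect (hardcore G fug) f| ≤ B := by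
  rw [← expect_const (hardcore G fug) c, ← expect_sub, expect_hardcore]
  have hw : ∀ X, 0 ≤ hardcoreWeight G fug X := fun X => by
    unfold hardcoreWeight
    split_ifs
    · exact Finset.prod_nonneg fun v _ => by split_ifs <;> simp
    · exact le_rfl
  have hpos : 0 < ∑ X, hardcoreWeight G fug X := by
    refine Finset.sum_pos' (fun X _ => hw X) ⟨fun _ => false, Finset.mem_univ _, ?_⟩
    simp [hardcoreWeight, isIndep_empty]
  rw [abs_div, abs_of_pos hpos, div_le_iff₀ hpos, Finset.mul_sum]
  refine (Finset.abs_sum_le_sum_abs _ _).trans (Finset.sum_le_sum fun X _ => ?_)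
  rw [abs_mul, abs_of_nonneg (hw X), mul_comm B]
  by_cases hX : IsIndep G X
  · exact mul_le_mul_of_nonneg_left (h X hX) (hw X)
  · simp [hardcoreWeight, hX]

/-- Moving the last transition onto `f` costs a factor `ρ` in the Lipschitz constant and leaves the
hardcore expectation unchanged; hence `L` and `f` vary in the induction. At time 0 the Hamming
diameter is the only bound needed. -/
theorem abs_expect_law_sub_le [DecidableRel G.Adj] {ρ : ℝ} (hρ0 : 0 ≤ ρ) (p : ℝ≥0) (hp : p ≤ 1)
    (fug : ℝ≥0)
    (hρ : ∀ X v, IsIndep G X → X v = true →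
      (expect (indep fun _ : V => hardcoreProposal p hp fug) fun σ =>
      (hammingDist (update G X σ) (update G (Function.update X v false) σ) : ℝ)) ≤ ρ)
    (t : ℕ) : ∀ (L : ℝ) (f : (V → Bool) → ℝ), 0 ≤ L → IndepLipschitz G L f →
    |expect ((hardcoreMRF V fug).law G p hp (fun _ => false) t) f - expect (hardcore G fug) f| ≤
      L * ρ ^ t * Fintype.card V := by
  induction t with
  | zero =>
    intro L f hL hf
    rw [PairwiseMRF.law, expect_pure, pow_zero, mul_one]
    refine abs_expect_hardcore_sub_le _ _ _ _ fun X hX => (hf _ _ isIndep_empty hX).trans ?_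
    gcongr
    exact hammingDist_le_card_fintype
  | succ t ih =>
    intro L f hL hf
    have := ih (L * ρ) _ (mul_nonneg hL hρ0) (hf.step hL p hp fug hρ)
    rw [expect_hardcore_update] at this
    rw [PairwiseMRF.law, expect_bind]
    simp only [hardcore_step, expect_map]
    rwa [pow_succ', ← mul_assoc]

theorem tvDist_law_hardcore_le [DecidableRel G.Adj] {ρ : ℝ} (hρ0 : 0 ≤ ρ) (p : ℝ≥0) (hp : p ≤ 1)
    (fug : ℝ≥0)
    (hρ : ∀ X v, IsIndep G X → X v = true →
      (expect (indep fun _ : V => hardcoreProposal p hp fug) fun σ =>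
      (hammingDist (update G X σ) (update G (Function.update X v false) σ) : ℝ)) ≤ ρ)
    (t : ℕ) :
    tvDist ((hardcoreMRF V fug).law G p hp (fun _ => false) t) (hardcore G fug) ≤
      ρ ^ t * Fintype.card V := by
  set μ := (hardcoreMRF V fug).law G p hp (fun _ => false) t with hμ
  set ν := hardcore G fug
  -- This test function attains the total variation distance; its values lie in [-1/2, 1/2] and
  -- distinct labellings have distance at least 1, so its Lipschitz constant is 1.
  set f : (V → Bool) → ℝ := fun X => (SignType.sign ((μ X).toReal - (ν X).toReal) : ℝ) / 2
  have h1 : tvDist μ ν = expect μ f - expect ν f := by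
    rw [tvDist, expect, expect, ← Finset.sum_sub_distrib, Finset.sum_div]
    refine Finset.sum_congr rfl fun X _ => ?_
    rw [← sign_mul_self]
    simp only [f]
    ring
  have hb : ∀ X, |f X| ≤ 1 / 2 := fun X => by
    simp only [f]
    rcases SignType.sign ((μ X).toReal - (ν X).toReal) with _ | _ | _ <;> norm_num
  have hf : IndepLipschitz G 1 f := by
    intro X Y _ _
    rw [one_mul]
    by_cases h : X = Y
    · simp [h]
    · have : (1 : ℝ) ≤ hammingDist X Y := by exact_mod_cast hammingDist_pos.mpr h
      have hX := abs_le.mp (hb X)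
      have hY := abs_le.mp (hb Y)
      rw [abs_le]
      constructor <;> linarith
  rw [h1]
  refine (le_abs_self _).trans ?_
  simpa using abs_expect_law_sub_le hρ0 p hp fug hρ t 1 f zero_le_one hf

/-- In the uniqueness regime `fug ≤ α / (Δ - 1)` the expected number of neighbours that propose
`true` is bounded away from `1`. -/
theorem degree_mul_fug_le {α x D : ℝ} (hα0 : 0 ≤ α) (hα1 : α < 1) (hD : 2 ≤ D) (hx : 0 ≤ x)
    (h : x ≤ α / (D - 1)) : D * (x / (x + 1)) ≤ 2 * α / (1 + α) := by
  rw [le_div_iff₀ (by linarith)] at h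
  rw [← mul_div_assoc, div_le_div_iff₀ (by linarith) (by linarith)]
  have h2 : x ≤ α := by nlinarith
  -- Substituting Dx ≤ α + x leaves x(1 - α) ≤ α(1 - α).
  nlinarith [mul_nonneg hα0 hx, mul_le_mul_of_nonneg_left h hα0,
    mul_le_mul_of_nonneg_right h2 (sub_nonneg.mpr hα1.le)]

/-- The choice of `p` gives db ≤ 1 - 2p for every degree d. By Bernoulli's inequality the bound is
at most 1 - p + (p + p²)db ≤ 1 - p² - 2p³. -/
theorem expect_hammingDist_update_le_of_fug [DecidableRel G.Adj] {α : ℝ} (hα0 : 0 ≤ α)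
    (hα1 : α < 1) (p : ℝ≥0) (hp : p ≤ 1) (fug : ℝ≥0)
    (hpα : (p : ℝ) = (1 - 2 * α / (1 + α)) / 2)
    (hΔ : 2 ≤ G.maxDegree) (hfug : (fug : ℝ) ≤ α / ((G.maxDegree : ℝ) - 1))
    (X : V → Bool) (v : V) (hX : IsIndep G X) (hv : X v = true) :
    (expect (indep fun _ : V => hardcoreProposal p hp fug) fun σ =>
      (hammingDist (update G X σ) (update G (Function.update X v false) σ) : ℝ)) ≤
      1 - (p : ℝ) ^ 2 := by
  classical
  refine (expect_hammingDist_update_le hX hv p hp fug).trans ?_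
  have hcard : ∀ _ : DecidablePred (G.Adj v),
      (Finset.univ.filter (G.Adj v)).card = G.degree v := fun _ => by
    rw [← G.card_neighborFinset_eq_degree]
    congr 1
    ext w
    simp
  rw [hcard]
  have hdΔ : (G.degree v : ℝ) ≤ G.maxDegree := by exact_mod_cast G.degree_le_maxDegree v
  generalize G.degree v = d at hdΔ
  set b : ℝ := fug / (fug + 1)
  have hb0 : 0 ≤ b := by positivity
  have hb1 : b ≤ 1 := by
    rw [div_le_one (by positivity)]
    linarith
  have hγ := degree_mul_fug_le hα0 hα1 (by exact_mod_cast hΔ : (2 : ℝ) ≤ G.maxDegree)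
    fug.coe_nonneg hfug
  have hp0 : (0 : ℝ) ≤ p := p.coe_nonneg
  have hp1 : (p : ℝ) ≤ 1 := by exact_mod_cast hp
  have hdb : d * b ≤ 1 - 2 * p := by
    have : (d : ℝ) * b ≤ G.maxDegree * b := by gcongr
    linarith
  have hpow := one_add_mul_le_pow (a := -(p * b)) (by nlinarith) d
  rw [← sub_eq_add_neg] at hpow
  have h3 := mul_le_mul_of_nonneg_left hpow hp0
  have h4 := mul_le_mul_of_nonneg_left hdb (by positivity : (0 : ℝ) ≤ p ^ 2 + p)
  have h5 : (0 : ℝ) ≤ (p : ℝ) ^ 3 := by positivity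
  nlinarith

end Mixing

/-! ### Protocols with large messages and their bitwise execution -/

/-- A synchronous all-to-all protocol with messages of type `Msg`; sending and receiving may
depend on the number of the round. -/
structure Protocol (n : ℕ) (Coins Msg State Out : Type) where
  init : (v : Fin n) → Set (Fin n) → Coins → State
  send : ℕ → (v : Fin n) → State → (receiver : Fin n) → Msg
  receive : ℕ → (v : Fin n) → State → (inbox : (sender : Fin n) → Msg) → State
  output : (v : Fin n) → State → Out

namespace Protocol

variable {n : ℕ} {Coins Msg State Out : Type} (Q : Protocol n Coins Msg State Out)

/-- The state of every machine after `r` rounds. -/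
def run (G : SimpleGraph (Fin n)) (ω : Fin n → Coins) : ℕ → Fin n → State
  | 0 => fun v => Q.init v (G.neighborSet v) (ω v)
  | r + 1 => fun v => Q.receive r v (run G ω r v) fun u => Q.send r u (run G ω r u) v

/-- `enc` and `dec` transmit by `L` bits the messages that satisfy `ok`, and an abort symbol
`none`; other messages are transmitted as the abort symbol. -/
structure IsCode (ok : Msg → Prop) (L : ℕ) (enc : Option Msg → ℕ → Bool)
    (dec : (ℕ → Bool) → Option Msg) : Prop where
  sound : ∀ x b m, (∀ j < L, b j = enc x j) → dec b = some m → x = some m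
  complete : ∀ m b, ok m → (∀ j < L, b j = enc (some m) j) → dec b = some m

/-- The state of a machine in the bitwise execution of a protocol. -/
structure BitState (n : ℕ) (State : Type) where
  state : Option State
  round : ℕ
  pos : ℕ
  buffer : Fin n → ℕ → Bool

open Classical in
/-- The transition of a machine that may have aborted. -/
def receiveOption (r : ℕ) (v : Fin n) (s : Option State) (inbox : Fin n → Option Msg) :
    Option State :=
  if h : ∀ u, (inbox u).isSome = true then
    s.map fun s => Q.receive r v s fun u => (inbox u).get (h u)
  else none

/-- The execution of a protocol with one-bit messages, in which `L` rounds transmit a message. -/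
def bitwise [Fintype Coins] (μ : PMF Coins) (L : ℕ) (enc : Option Msg → ℕ → Bool)
    (dec : (ℕ → Bool) → Option Msg) : CongestedCliqueAlg n 1 Out where
  Coins := Coins
  coinLaw := μ
  State := BitState n State
  init v N c := ⟨some (Q.init v N c), 0, 0, fun _ _ => false⟩
  send v s w := fun _ => enc (s.state.map fun x => Q.send s.round v x w) s.pos
  receive v s inbox :=
    if s.pos + 1 = L then
      ⟨Q.receiveOption s.round v s.state
        fun u => dec (Function.update (s.buffer u) s.pos (inbox u 0)), s.round + 1, 0, s.buffer⟩
    else ⟨s.state, s.round, s.pos + 1, fun u => Function.update (s.buffer u) s.pos (inbox u 0)⟩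
  output v s := s.state.map (Q.output v)

variable [Fintype Coins] {μ : PMF Coins} {L : ℕ} {enc : Option Msg → ℕ → Bool}
  {dec : (ℕ → Bool) → Option Msg}

/-- The simulated states after `r` rounds of the protocol. -/
def simulated (μ : PMF Coins) (L : ℕ) (enc : Option Msg → ℕ → Bool)
    (dec : (ℕ → Bool) → Option Msg) (G : SimpleGraph (Fin n)) (ω : Fin n → Coins) (r : ℕ)
    (v : Fin n) : Option State :=
  ((Q.bitwise μ L enc dec).stateAfter G ω (L * r) v).state

theorem bitwise_stateAfter_succ (G : SimpleGraph (Fin n)) (ω : Fin n → Coins) (m : ℕ)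
    (v : Fin n) :
    (Q.bitwise μ L enc dec).stateAfter G ω (m + 1) v =
      (Q.bitwise μ L enc dec).receive v ((Q.bitwise μ L enc dec).stateAfter G ω m v) fun u =>
        (Q.bitwise μ L enc dec).send u ((Q.bitwise μ L enc dec).stateAfter G ω m u) v := rfl

theorem bitwise_stateAfter (G : SimpleGraph (Fin n)) (ω : Fin n → Coins) (r : ℕ)
    (hr : ∀ v, ((Q.bitwise μ L enc dec).stateAfter G ω (L * r) v).round = r ∧
      ((Q.bitwise μ L enc dec).stateAfter G ω (L * r) v).pos = 0) (j : ℕ) (hj : j < L) (v : Fin n) :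
    ∃ b, (Q.bitwise μ L enc dec).stateAfter G ω (L * r + j) v =
        (⟨Q.simulated μ L enc dec G ω r v, r, j, b⟩ : BitState n State) ∧
      ∀ u, ∀ i < j, b u i =
        enc ((Q.simulated μ L enc dec G ω r u).map fun x => Q.send r u x v) i := by
  induction j generalizing v with
  | zero =>
    refine ⟨((Q.bitwise μ L enc dec).stateAfter G ω (L * r) v).buffer, ?_, by simp⟩
    obtain ⟨h1, h2⟩ := hr v
    have eta : ∀ s : BitState n State, s.round = r → s.pos = 0 →
        s = ⟨s.state, r, 0, s.buffer⟩ := by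
      rintro ⟨_, _, _, _⟩ rfl rfl
      rfl
    exact eta _ h1 h2
  | succ j ih =>
    obtain ⟨b, hb, hb2⟩ := ih (by omega) v
    choose c hc hc2 using ih (by omega)
    rw [← add_assoc]
    refine ⟨fun u => Function.update (b u) j
      (enc ((Q.simulated μ L enc dec G ω r u).map fun x => Q.send r u x v) j), ?_, ?_⟩
    · rw [bitwise_stateAfter_succ, hb]
      simp only [hc]
      simp only [bitwise]
      rw [if_neg (by omega)]
    · intro u i hi
      by_cases h : i = j
      · subst h; simp
      · dsimp only
        rw [Function.update_of_ne h]
        exact hb2 u i (by omega)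

theorem bitwise_round (hL : 0 < L) (G : SimpleGraph (Fin n)) (ω : Fin n → Coins) (r : ℕ) :
    (∀ v, ((Q.bitwise μ L enc dec).stateAfter G ω (L * r) v).round = r ∧
      ((Q.bitwise μ L enc dec).stateAfter G ω (L * r) v).pos = 0) ∧
    ∀ v, ∃ b : Fin n → ℕ → Bool,
      (∀ u, ∀ i < L, b u i =
        enc ((Q.simulated μ L enc dec G ω r u).map fun x => Q.send r u x v) i) ∧
      Q.simulated μ L enc dec G ω (r + 1) v =
        Q.receiveOption r v (Q.simulated μ L enc dec G ω r v) fun u => dec (b u) := by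
  have step : ∀ r, (∀ v, ((Q.bitwise μ L enc dec).stateAfter G ω (L * r) v).round = r ∧
      ((Q.bitwise μ L enc dec).stateAfter G ω (L * r) v).pos = 0) → ∀ v,
      ∃ b b' : Fin n → ℕ → Bool,
      (∀ u, ∀ i < L, b u i =
        enc ((Q.simulated μ L enc dec G ω r u).map fun x => Q.send r u x v) i) ∧
      (Q.bitwise μ L enc dec).stateAfter G ω (L * (r + 1)) v =
        (⟨Q.receiveOption r v (Q.simulated μ L enc dec G ω r v) fun u => dec (b u), r + 1, 0, b'⟩ :
          BitState n State) := by
    intro r hr v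
    -- Only the last round of a block decodes, so it is split off from the `k` buffering rounds.
    obtain ⟨k, rfl⟩ : ∃ k, L = k + 1 := ⟨L - 1, by omega⟩
    choose c hc hc2 using Q.bitwise_stateAfter G ω r hr k (by omega)
    refine ⟨fun u => Function.update (c v u) k
      (enc ((Q.simulated μ (k + 1) enc dec G ω r u).map fun x => Q.send r u x v) k), c v, ?_, ?_⟩
    · intro u i hi
      by_cases h : i = k
      · subst h; simp
      · dsimp only
        rw [Function.update_of_ne h]
        exact hc2 v u i (by omega)
    · rw [show (k + 1) * (r + 1) = (k + 1) * r + k + 1 by ring, bitwise_stateAfter_succ]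
      simp only [hc]
      simp only [bitwise]
      rw [if_pos trivial]
  have inv : ∀ r v, ((Q.bitwise μ L enc dec).stateAfter G ω (L * r) v).round = r ∧
      ((Q.bitwise μ L enc dec).stateAfter G ω (L * r) v).pos = 0 := by
    intro r
    induction r with
    | zero => exact fun v => ⟨rfl, rfl⟩
    | succ r ih =>
      intro v
      obtain ⟨b, b', _, h⟩ := step r ih v
      rw [h]
      exact ⟨rfl, rfl⟩
  refine ⟨inv r, fun v => ?_⟩
  obtain ⟨b, b', h1, h2⟩ := step r (inv r) v
  exact ⟨b, h1, congrArg BitState.state h2⟩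

/-- A machine survives a round only if it decodes a message from every sender. By soundness of the
code these are genuine messages of senders that have not aborted, so induction applies to all of
them. -/
theorem simulated_sound {ok : Msg → Prop} (hcode : IsCode ok L enc dec) (hL : 0 < L)
    (G : SimpleGraph (Fin n)) (ω : Fin n → Coins) (r : ℕ) (v : Fin n) (s : State)
    (hs : Q.simulated μ L enc dec G ω r v = some s) : s = Q.run G ω r v := by
  induction r generalizing v s with
  | zero => exact (Option.some_inj.mp hs).symm
  | succ r ih =>
    obtain ⟨b, hb, h⟩ := (Q.bitwise_round (μ := μ) (enc := enc) (dec := dec) hL G ω r).2 v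
    rw [h, receiveOption] at hs
    split_ifs at hs with h2
    obtain ⟨s', hs', rfl⟩ := Option.map_eq_some_iff.mp hs
    rw [run, ih v s' hs']
    congr 1
    funext u
    have h3 := hcode.sound _ _ ((dec (b u)).get (h2 u)) (hb u) (by simp)
    obtain ⟨x, hx, hx2⟩ := Option.map_eq_some_iff.mp h3
    rw [← hx2, ih u x hx]

theorem simulated_complete {ok : Msg → Prop} (hcode : IsCode ok L enc dec) (hL : 0 < L)
    (G : SimpleGraph (Fin n)) (ω : Fin n → Coins) (r : ℕ)
    (h : ∀ k < r, ∀ u v, ok (Q.send k u (Q.run G ω k u) v)) (v : Fin n) :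
    Q.simulated μ L enc dec G ω r v = some (Q.run G ω r v) := by
  induction r generalizing v with
  | zero => rfl
  | succ r ih =>
    obtain ⟨b, hb, hr⟩ := (Q.bitwise_round (μ := μ) (enc := enc) (dec := dec) hL G ω r).2 v
    have ih' := ih fun k hk => h k (by omega)
    simp only [ih', Option.map_some] at hb
    have hd : ∀ u, dec (b u) = some (Q.send r u (Q.run G ω r u) v) := fun u =>
      hcode.complete _ _ (h r (by omega) u v) (hb u)
    rw [hr, ih', receiveOption]
    simp only [hd, Option.isSome_some, implies_true, dite_true, Option.map_some, Option.get_some]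
    rfl

theorem bitwise_outputAfter (G : SimpleGraph (Fin n)) (ω : Fin n → Coins) (r : ℕ) (v : Fin n) :
    (Q.bitwise μ L enc dec).outputAfter G ω (L * r) v =
      (Q.simulated μ L enc dec G ω r v).map (Q.output v) := rfl

end Protocol

/-! ### Sparse messages -/

/-- A message with a pair of bits for every machine. -/
abbrev PairMsg (n : ℕ) : Type := Fin n → Bool × Bool

/-- The machines for which a message has a nonzero entry. -/
def PairMsg.support {n : ℕ} (m : PairMsg n) : Finset (Fin n) :=
  Finset.univ.filter fun x => m x ≠ (false, false)

/-- A message with at most `K` nonzero entries is determined by a list of `K` optional triples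
(position and two bits), each with 4n + 1 possible values and thus fitting into `l` bits. -/
theorem exists_isCode {n K l : ℕ} (hl : 4 * n + 1 ≤ 2 ^ l) :
    ∃ (enc : Option (PairMsg n) → ℕ → Bool) (dec : (ℕ → Bool) → Option (PairMsg n)),
      Protocol.IsCode (fun m : PairMsg n => m.support.card ≤ K) (K * l + 1) enc dec := by
  classical
  have hcard : Fintype.card (Fin K → Option (Fin n × Bool × Bool)) ≤
      Fintype.card (Fin (K * l) → Bool) := by
    simp only [Fintype.card_pi_const, Fintype.card_option, Fintype.card_prod, Fintype.card_fin,
      Fintype.card_bool]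
    rw [mul_comm K, pow_mul]
    exact Nat.pow_le_pow_left (by omega) K
  obtain ⟨e⟩ := Function.Embedding.nonempty_of_card_le hcard
  let list : PairMsg n → Fin K → Option (Fin n × Bool × Bool) := fun m j =>
    m.support.toList[(j : ℕ)]?.map fun x => (x, m x)
  have hlist : ∀ m : PairMsg n, m.support.card ≤ K → ∀ x y, y ≠ (false, false) →
      ((∃ j, list m j = some (x, y)) ↔ m x = y) := by
    intro m hm x y hy
    constructor
    · rintro ⟨j, hj⟩
      obtain ⟨z, _, hz⟩ := Option.map_eq_some_iff.mp hj
      rw [Prod.mk.injEq] at hz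
      rw [← hz.2, hz.1]
    · rintro rfl
      have hx : x ∈ m.support.toList := by simpa [PairMsg.support] using hy
      obtain ⟨j, hj, hjx⟩ := List.mem_iff_getElem.mp hx
      refine ⟨⟨j, lt_of_lt_of_le (by simpa using hj) hm⟩, ?_⟩
      simp [list, List.getElem?_eq_getElem hj, hjx]
  have hinj : ∀ m m' : PairMsg n, m.support.card ≤ K → m'.support.card ≤ K →
      list m = list m' → m = m' := by
    intro m m' hm hm' h
    funext x
    by_cases h0 : m x = (false, false)
    · by_contra hne
      have h1 : m' x ≠ (false, false) := fun h => hne (h0.trans h.symm)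
      have h2 := (hlist m' hm' x _ h1).mpr rfl
      rw [← h] at h2
      exact hne ((hlist m hm x _ h1).mp h2)
    · have h2 := (hlist m hm x _ h0).mpr rfl
      rw [h] at h2
      exact ((hlist m' hm' x _ h0).mp h2).symm
  -- The extra bit at index `K * l` is `true` exactly for messages within the bound; the abort word
  -- is all `false`.
  let enc : Option (PairMsg n) → ℕ → Bool := fun x => match x with
    | none => fun _ => false
    | some m => if m.support.card ≤ K then
        fun j => if h : j < K * l then e (list m) ⟨j, h⟩ else true
      else fun _ => false
  have henc : ∀ m : PairMsg n, m.support.card ≤ K → ∀ x,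
      (∀ j < K * l + 1, enc (some m) j = enc x j) → x = some m := by
    intro m hm x hx
    have hlast := hx (K * l) (by omega)
    rcases x with _ | m'
    · simp [enc, hm] at hlast
    · by_cases hm' : m'.support.card ≤ K
      · congr 1
        refine hinj m' m hm' hm (e.injective (funext fun j => ?_))
        have := hx j (by omega)
        simpa [enc, hm, hm'] using this.symm
      · simp [enc, hm, hm'] at hlast
  refine ⟨enc, fun b => if h : ∃ m : PairMsg n, m.support.card ≤ K ∧
    ∀ j < K * l + 1, b j = enc (some m) j then some h.choose else none, ?_, ?_⟩
  · intro x b m hb hd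
    split_ifs at hd with h
    rw [Option.some_inj] at hd
    obtain ⟨h1, h2⟩ := h.choose_spec
    rw [hd] at h1 h2
    exact henc m h1 x fun j hj => (h2 j hj).symm.trans (hb j hj)
  · intro m b hm hb
    have h : ∃ m : PairMsg n, m.support.card ≤ K ∧
      ∀ j < K * l + 1, b j = enc (some m) j := ⟨m, hm, hb⟩
    rw [dif_pos h]
    obtain ⟨h1, h2⟩ := h.choose_spec
    exact (henc _ h1 (some m) fun j hj => (h2 j hj).symm.trans (hb j hj)).symm

/-! ### Trajectories and their law -/

section Trajectory

variable {V : Type} (G : SimpleGraph V)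

/-- The labelling of the hardcore chain after `t` transitions from the empty independent set with
proposals `τ`. -/
def trajectory (τ : ℕ → V → Option Bool) : ℕ → V → Bool
  | 0 => fun _ => false
  | t + 1 => update G (trajectory τ t) (τ t)

theorem trajectory_congr {τ τ' : ℕ → V → Option Bool} {t : ℕ} (h : ∀ s < t, τ s = τ' s) :
    trajectory G τ t = trajectory G τ' t := by
  induction t with
  | zero => rfl
  | succ t ih => rw [trajectory, trajectory, ih fun s hs => h s (by omega), h t (by omega)]

-- The chain starts empty, so a label `true` stems from an earlier proposal. This lets one event per
-- machine and sample control the traffic of all transitions.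
variable {G} in
theorem exists_proposal_of_trajectory {τ : ℕ → V → Option Bool} {t : ℕ} {v : V}
    (h : trajectory G τ t v = true) : ∃ s < t, τ s v = some true := by
  induction t with
  | zero => simp [trajectory] at h
  | succ t ih =>
    by_cases ha : Accepted G (trajectory G τ t) (τ t) v
    · exact ⟨t, by omega, (update_of_accepted ha).trans (congrArg some h)⟩
    · rw [trajectory, update_of_not_accepted ha] at h
      obtain ⟨s, hs, hs2⟩ := ih h
      exact ⟨s, by omega, hs2⟩

/-- Extends finitely many proposals by inactivity. -/
def extend {T : ℕ} (c : Fin T → Option Bool) (t : ℕ) : Option Bool :=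
  if h : t < T then c ⟨t, h⟩ else none

theorem expect_indep_snoc {α : Type} [Fintype α] (μ : PMF α) (t : ℕ)
    (f : (Fin (t + 1) → α) → ℝ) :
    expect (indep fun _ : Fin (t + 1) => μ) f =
      expect (indep fun _ : Fin t => μ) fun τ => expect μ fun a =>
        f (Fin.snoc (α := fun _ => α) τ a) := by
  simp only [expect, indep_toReal]
  rw [← (Fin.snocEquiv fun _ => α).sum_comp, Fintype.sum_prod_type, Finset.sum_comm]
  refine Finset.sum_congr rfl fun τ _ => ?_
  rw [Finset.mul_sum]
  refine Finset.sum_congr rfl fun a _ => ?_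
  simp only [Fin.snocEquiv, Equiv.coe_fn_mk, Fin.prod_univ_castSucc, Fin.snoc_castSucc,
    Fin.snoc_last, mul_assoc]

theorem indep_comm {ι κ α : Type} [Fintype ι] [DecidableEq ι] [Fintype κ] [DecidableEq κ]
    [Fintype α] (μ : PMF α) :
    (indep fun _ : ι => indep fun _ : κ => μ).map (fun ω k i => ω i k) =
      indep fun _ : κ => indep fun _ : ι => μ := by
  refine ext_of_expect fun f => ?_
  rw [expect_map]
  simp only [expect, indep_toReal]
  rw [← (Equiv.piComm fun (_ : κ) (_ : ι) => α).sum_comp]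
  refine Finset.sum_congr rfl fun ω _ => ?_
  rw [Finset.prod_comm]
  rfl

variable [Fintype V] [DecidableEq V] [DecidableRel G.Adj]

theorem law_eq_map_trajectory (p : ℝ≥0) (hp : p ≤ 1) (fug : ℝ≥0) (t : ℕ) :
    (hardcoreMRF V fug).law G p hp (fun _ => false) t =
      (indep fun _ : V => indep fun _ : Fin t => hardcoreProposal p hp fug).map
        fun c => trajectory G (fun s v => extend (c v) s) t := by
  have main : (hardcoreMRF V fug).law G p hp (fun _ => false) t =
      (indep fun _ : Fin t => indep fun _ : V => hardcoreProposal p hp fug).map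
        fun c => trajectory G (fun s v => extend (fun r => c r v) s) t := by
    induction t with
    | zero =>
      refine ext_of_expect fun f => ?_
      simp only [PairwiseMRF.law, expect_pure, expect_map, trajectory, expect_const]
    | succ t ih =>
      refine ext_of_expect fun f => ?_
      rw [PairwiseMRF.law, ih, expect_bind, expect_map, expect_map, expect_indep_snoc]
      congr 1
      funext τ
      rw [hardcore_step, expect_map]
      congr 1
      funext σ
      rw [trajectory]
      congr 2
      · refine trajectory_congr G fun s hs => funext fun v => ?_
        rw [extend, extend, dif_pos hs, dif_pos (by omega)]
        exact congrFun (Fin.snoc_castSucc (α := fun _ => V → Option Bool) σ τ ⟨s, hs⟩).symm v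
      · funext v
        rw [extend, dif_pos (by omega)]
        exact congrFun (Fin.snoc_last (α := fun _ => V → Option Bool) σ τ).symm v
  rw [main, ← indep_comm, PMF.map_comp]
  rfl

/-- Different samples use disjoint blocks of independent proposals. Communication does not enter, so
the law is exact without conditioning on success. -/
theorem map_trajectory_indep {κ : Type} [Fintype κ] [DecidableEq κ] (p : ℝ≥0) (hp : p ≤ 1)
    (fug : ℝ≥0) (T : ℕ) :
    (indep fun _ : V => indep fun _ : κ => indep fun _ : Fin T =>
        hardcoreProposal p hp fug).map
      (fun ω i => trajectory G (fun s v => extend (ω v i) s) T) =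
    indep fun _ : κ => (hardcoreMRF V fug).law G p hp (fun _ => false) T := by
  simp only [law_eq_map_trajectory]
  rw [indep_map, ← indep_comm, PMF.map_comp]
  rfl

end Trajectory

/-! ### Load -/

section Load

variable {n T : ℕ}

open Classical in
/-- The number of pairs of a machine and a sample in `A` such that the machine ever proposes
`true` in the sample. -/
def load (A : Finset (Fin n × Fin n)) (ω : Fin n → Fin n → Fin T → Option Bool) : ℕ :=
  (A.filter fun a => ∃ t, ω a.1 a.2 t = some true).card

open Classical in
theorem expect_exists_proposal_le (p : ℝ≥0) (hp : p ≤ 1) (fug : ℝ≥0) :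
    expect (indep fun _ : Fin T => hardcoreProposal p hp fug)
      (fun c => if ∃ t, c t = some true then 1 else 0) ≤ T * (p * (fug / (fug + 1))) := by
  refine (expect_mono _ (g := fun c => ∑ t, if c t = some true then 1 else 0)
    fun c => ?_).trans_eq ?_
  · have h0 : ∀ t ∈ Finset.univ, (0 : ℝ) ≤ if c t = some true then 1 else 0 := fun t _ => by
      split_ifs <;> norm_num
    split_ifs with h
    · obtain ⟨t, ht⟩ := h
      refine le_trans ?_ (Finset.single_le_sum h0 (Finset.mem_univ t))
      simp [ht]
    · exact Finset.sum_nonneg h0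
  · rw [expect_sum, Finset.sum_congr rfl fun t _ => expect_indep_eval
      (fun _ : Fin T => hardcoreProposal p hp fug) t (fun a => if a = some true then (1 : ℝ) else 0)]
    rw [Finset.sum_const, nsmul_eq_mul]
    simp [expect_hardcoreProposal]

-- The variable is a product over `A` of the independent factors 1 + indicator.
open Classical in
theorem expect_two_pow_load (μ : PMF (Fin T → Option Bool)) (A : Finset (Fin n × Fin n)) :
    expect (indep fun _ : Fin n => indep fun _ : Fin n => μ) (fun ω => (2 : ℝ) ^ load A ω) =
      (1 + expect μ fun c => if ∃ t, c t = some true then 1 else 0) ^ A.card := by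
  have h1 : ∀ ω : Fin n → Fin n → Fin T → Option Bool, (2 : ℝ) ^ load A ω =
      ∏ u, ∏ i, if (u, i) ∈ A then 1 + (if ∃ t, ω u i t = some true then (1 : ℝ) else 0) else 1 := by
    intro ω
    rw [← Fintype.prod_prod_type'
      (fun u i => if (u, i) ∈ A then 1 + (if ∃ t, ω u i t = some true then (1 : ℝ) else 0) else 1)]
    simp only [Prod.mk.eta]
    rw [← Finset.prod_filter, Finset.filter_mem_eq_inter, Finset.univ_inter, load,
      ← Finset.prod_const, Finset.prod_filter]
    refine Finset.prod_congr rfl fun a _ => ?_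
    split_ifs <;> norm_num
  simp only [h1]
  rw [expect_indep_prod (fun _ : Fin n => indep fun _ : Fin n => μ) (fun u c => ∏ i,
    if (u, i) ∈ A then 1 + (if ∃ t, c i t = some true then (1 : ℝ) else 0) else 1)]
  rw [Finset.prod_congr rfl fun u _ => expect_indep_prod (fun _ : Fin n => μ) (fun i c =>
    if (u, i) ∈ A then 1 + (if ∃ t, c t = some true then (1 : ℝ) else 0) else 1)]
  rw [← Fintype.prod_prod_type' (fun u i => expect μ fun c =>
    if (u, i) ∈ A then 1 + (if ∃ t, c t = some true then (1 : ℝ) else 0) else 1)]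
  simp only [Prod.mk.eta]
  have h2 : ∀ a : Fin n × Fin n, (expect μ fun c =>
      if a ∈ A then 1 + (if ∃ t, c t = some true then (1 : ℝ) else 0) else 1) =
      if a ∈ A then 1 + expect μ (fun c => if ∃ t, c t = some true then (1 : ℝ) else 0) else 1 := by
    intro a
    by_cases h : a ∈ A
    · simp only [h, if_true, expect_add, expect_const]
    · simp only [h, if_false, expect_const]
  simp only [h2]
  rw [← Finset.prod_filter, Finset.filter_mem_eq_inter, Finset.univ_inter, Finset.prod_const]

-- Markov's inequality for 2^load: with q the probability of ever proposing `true`, Dq ≤ T, so the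
-- moment is at most (1 + q)^D ≤ e^T ≤ 4^T.
open Classical in
theorem expect_lt_load_le (p : ℝ≥0) (hp : p ≤ 1) (fug : ℝ≥0) (K D : ℕ)
    (hD : D * ((fug : ℝ) / (fug + 1)) ≤ 1) (A : Finset (Fin n × Fin n)) (hA : A.card ≤ D) :
    expect (indep fun _ : Fin n => indep fun _ : Fin n => indep fun _ : Fin T =>
      hardcoreProposal p hp fug) (fun ω => if K < load A ω then 1 else 0) ≤
      2 ^ (2 * T) / 2 ^ K := by
  refine (expect_mono _ (g := fun ω => ((2 : ℝ) ^ K)⁻¹ * 2 ^ load A ω) fun ω => ?_).trans ?_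
  · split_ifs with h
    · rw [inv_mul_eq_div, one_le_div (by positivity)]
      exact pow_le_pow_right₀ (by norm_num) h.le
    · positivity
  rw [expect_const_mul, expect_two_pow_load, inv_mul_eq_div]
  gcongr
  set q := expect (indep fun _ : Fin T => hardcoreProposal p hp fug)
      (fun c => if ∃ t, c t = some true then 1 else 0) with hq
  have hq0 : 0 ≤ q := by
    rw [← expect_const (indep fun _ : Fin T => hardcoreProposal p hp fug) 0]
    exact expect_mono _ fun c => by split_ifs <;> norm_num
  have hp0 : (0 : ℝ) ≤ p := p.coe_nonneg
  have hp1 : (p : ℝ) ≤ 1 := by exact_mod_cast hp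
  have hqD : D * q ≤ T := by
    have h1 : q ≤ T * (p * (fug / (fug + 1))) := expect_exists_proposal_le p hp fug
    have h2 : (D : ℝ) * q ≤ D * (T * (p * (fug / (fug + 1)))) := by gcongr
    have h3 : p * (D * ((fug : ℝ) / (fug + 1))) ≤ 1 := by nlinarith
    have h4 := mul_le_mul_of_nonneg_left h3 (Nat.cast_nonneg (α := ℝ) T)
    linarith
  calc (1 + q) ^ A.card ≤ (1 + q) ^ D := pow_le_pow_right₀ (by linarith) hA
    _ ≤ Real.exp q ^ D := by
      gcongr
      linarith [Real.add_one_le_exp q]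
    _ = Real.exp (D * q) := (Real.exp_nat_mul _ _).symm
    _ ≤ Real.exp (T * 1) := Real.exp_le_exp.mpr (by simpa using hqD)
    _ = Real.exp 1 ^ T := Real.exp_nat_mul _ _
    _ ≤ 4 ^ T := by
      gcongr
      linarith [Real.exp_one_lt_d9]
    _ = 2 ^ (2 * T) := by rw [pow_mul]; norm_num

end Load

/-! ### The sampling protocol -/

section Sampler

variable {n T : ℕ}

open Classical in
/-- The new label of a vertex with label `x` and proposal `s`, when `m` holds the labels of its
neighbours and whether they propose `true`. -/
def localUpdate (x : Bool) (s : Option Bool) (m : PairMsg n) : Bool :=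
  if s.isSome = true ∧ ∀ u, ¬(x = true ∧ (m u).2 = true) ∧ ¬(s = some true ∧ (m u).1 = true) ∧
    ¬(s = some true ∧ (m u).2 = true) then s.getD false else x

/-- An entry `(false, false)` blocks nothing, so it can stand for a non-neighbour. Of a neighbour's
proposal only whether it is `true` matters. -/
theorem update_eq_localUpdate (G : SimpleGraph (Fin n)) (X : Fin n → Bool)
    (σ : Fin n → Option Bool) (v : Fin n) (m : PairMsg n)
    (h1 : ∀ u, G.Adj v u → m u = (X u, decide (σ u = some true)))
    (h2 : ∀ u, ¬G.Adj v u → m u = (false, false)) :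
    update G X σ v = localUpdate (X v) (σ v) m := by
  unfold update localUpdate Accepted
  congr 1
  refine propext (and_congr_right fun _ => forall_congr' fun u => ?_)
  by_cases h : G.Adj v u
  · simp [h1 u h, h, EdgeOk]
  · simp [h2 u h, h]

/-- The state of a machine in the sampling protocol: its neighbours, its proposals, its labels in
all samples, and the messages of the last round. -/
structure SamplerState (n T : ℕ) where
  nbrs : Set (Fin n)
  coins : Fin n → Fin T → Option Bool
  labels : Fin n → Bool
  inbox : Fin n → PairMsg n

open Classical in
/-- The sampling protocol. In every second round, `u` sends its label and proposal in sample `i`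
for its neighbour `v` to the relay `i + v`; in the next round the relays forward them. -/
def sampler (n T : ℕ) [NeZero n] :
    Protocol n (Fin n → Fin T → Option Bool) (PairMsg n) (SamplerState n T) (Fin n → Bool) where
  init _ N c := ⟨N, c, fun _ => false, fun _ _ => (false, false)⟩
  send r _ s w :=
    if r % 2 = 0 then fun x => if x ∈ s.nbrs then
      (s.labels (w - x), decide (extend (s.coins (w - x)) (r / 2) = some true)) else (false, false)
    else fun x => s.inbox x w
  receive r v s inbox :=
    if r % 2 = 0 then ⟨s.nbrs, s.coins, s.labels, inbox⟩
    else ⟨s.nbrs, s.coins,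
      fun i => localUpdate (s.labels i) (extend (s.coins i) (r / 2)) (inbox (i + v)), s.inbox⟩
  output _ s := s.labels

variable (G : SimpleGraph (Fin n)) (ω : Fin n → Fin n → Fin T → Option Bool)

/-- The samples determined by the proposals of all machines. -/
def sample (t : ℕ) (i : Fin n) : Fin n → Bool :=
  trajectory G (fun s v => extend (ω v i) s) t

open Classical in
/-- The message of `u` for `x` about sample `i` in transition `t`. -/
def sampleMsg (t : ℕ) (i u x : Fin n) : Bool × Bool :=
  if G.Adj u x then (sample G ω t i u, decide (extend (ω u i) t = some true)) else (false, false)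

theorem sampleMsg_ne {t : ℕ} {i u x : Fin n} (h : sampleMsg G ω t i u x ≠ (false, false)) :
    G.Adj u x ∧ ∃ s, ω u i s = some true := by
  have hex : ∀ s, extend (ω u i) s = some true → ∃ s, ω u i s = some true := by
    intro s hs
    unfold extend at hs
    split_ifs at hs with h
    exact ⟨_, hs⟩
  unfold sampleMsg at h
  split_ifs at h with hadj
  · refine ⟨hadj, ?_⟩
    by_cases h1 : sample G ω t i u = true
    · obtain ⟨s, _, hs⟩ := exists_proposal_of_trajectory h1
      exact hex s hs
    · refine hex t ?_
      by_contra h2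
      simp [h1, h2] at h
  · simp at h

section

variable [DecidableRel G.Adj]

/-- The pairs of a machine and a sample that `u` sends to the relay `w`. -/
def outLoad (u w : Fin n) : Finset (Fin n × Fin n) :=
  (G.neighborFinset u).image fun x => (u, w - x)

/-- The pairs of a machine and a sample that the relay `w` forwards to `v`. -/
def inLoad (w v : Fin n) : Finset (Fin n × Fin n) :=
  (G.neighborFinset v).image fun x => (x, w - v)

theorem card_outLoad_le (u w : Fin n) : (outLoad G u w).card ≤ G.maxDegree :=
  Finset.card_image_le.trans (by simpa using G.degree_le_maxDegree u)

theorem card_inLoad_le (w v : Fin n) : (inLoad G w v).card ≤ G.maxDegree :=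
  Finset.card_image_le.trans (by simpa using G.degree_le_maxDegree v)

end

variable [NeZero n]

/-- The message bound for round `2 * t + 1` is not needed here: this is the ideal protocol, in which
relay `v` holds for each receiver `x` the data of the single sample `v - x`. -/
theorem sampler_run (t : ℕ) :
    (∀ v, ((sampler n T).run G ω (2 * t) v).nbrs = G.neighborSet v ∧
      ((sampler n T).run G ω (2 * t) v).coins = ω v ∧
      ((sampler n T).run G ω (2 * t) v).labels = fun i => sample G ω t i v) ∧
    ∀ v, ((sampler n T).run G ω (2 * t + 1) v).inbox = fun u x => sampleMsg G ω t (v - x) u x := by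
  have step : ∀ t, (∀ v, ((sampler n T).run G ω (2 * t) v).nbrs = G.neighborSet v ∧
      ((sampler n T).run G ω (2 * t) v).coins = ω v ∧
      ((sampler n T).run G ω (2 * t) v).labels = fun i => sample G ω t i v) →
      ∀ v, ((sampler n T).run G ω (2 * t + 1) v).inbox =
        fun u x => sampleMsg G ω t (v - x) u x := by
    intro t h v
    funext u x
    obtain ⟨h1, h2, h3⟩ := h u
    have e1 : 2 * t % 2 = 0 := by omega
    have e2 : 2 * t / 2 = t := by omega
    rw [Protocol.run]
    generalize (sampler n T).run G ω (2 * t) = s at h1 h2 h3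
    have hx : x ∈ (s u).nbrs ↔ G.Adj u x := by rw [h1, SimpleGraph.mem_neighborSet]
    simp only [sampler, e1, e2, if_true, h2, h3, sampleMsg]
    split_ifs <;> tauto
  have main : ∀ v, ((sampler n T).run G ω (2 * t) v).nbrs = G.neighborSet v ∧
      ((sampler n T).run G ω (2 * t) v).coins = ω v ∧
      ((sampler n T).run G ω (2 * t) v).labels = fun i => sample G ω t i v := by
    induction t with
    | zero => exact fun v => ⟨rfl, rfl, rfl⟩
    | succ t ih =>
      intro v
      obtain ⟨h1, h2, h3⟩ := ih v
      have hin := step t ih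
      have e1 : ¬(2 * t + 1) % 2 = 0 := by omega
      have e2 : (2 * t + 1) / 2 = t := by omega
      have e3 : 2 * t % 2 = 0 := by omega
      have hA : ((sampler n T).run G ω (2 * t + 1) v).nbrs = G.neighborSet v ∧
          ((sampler n T).run G ω (2 * t + 1) v).coins = ω v ∧
          ((sampler n T).run G ω (2 * t + 1) v).labels = fun i => sample G ω t i v := by
        have e : (sampler n T).run G ω (2 * t + 1) v =
            { (sampler n T).run G ω (2 * t) v with
              inbox := ((sampler n T).run G ω (2 * t + 1) v).inbox } := by
          conv_lhs => rw [Protocol.run]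
          simp only [Protocol.run, sampler, e3, if_true]
        rw [e]
        exact ⟨h1, h2, h3⟩
      have e : (sampler n T).run G ω (2 * (t + 1)) v =
          { (sampler n T).run G ω (2 * t + 1) v with
            labels := fun i => localUpdate (((sampler n T).run G ω (2 * t + 1) v).labels i)
              (extend (((sampler n T).run G ω (2 * t + 1) v).coins i) t)
              fun u => ((sampler n T).run G ω (2 * t + 1) (i + v)).inbox u v } := by
        rw [show 2 * (t + 1) = 2 * t + 1 + 1 by ring, Protocol.run]
        generalize (sampler n T).run G ω (2 * t + 1) = s
        simp only [sampler, e1, e2, if_false]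
      rw [e]
      refine ⟨hA.1, hA.2.1, ?_⟩
      funext i
      -- Relay `i + v` holds sample `(i + v) - v = i` for receiver `v`.
      simp only [hA.2.1, hA.2.2, hin, add_sub_cancel_right]
      rw [show sample G ω (t + 1) i = update G (sample G ω t i) fun v => extend (ω v i) t from rfl]
      refine (update_eq_localUpdate G (sample G ω t i)
        (fun v => extend (ω v i) t) v _ (fun u hu => ?_) fun u hu => ?_).symm
      · simp [sampleMsg, hu.symm]
      · simp [sampleMsg, mt SimpleGraph.Adj.symm hu]
  exact ⟨main, step t main⟩

/-- Nonzero entries inject into the counted pairs: one machine and distinct samples on the way to a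
relay, distinct machines and one sample on the way from it. The bound does not depend on the round.
-/
theorem card_support_send_le [DecidableRel G.Adj] (K r : ℕ)
    (h1 : ∀ u w, load (outLoad G u w) ω ≤ K) (h2 : ∀ w v, load (inLoad G w v) ω ≤ K)
    (u v : Fin n) :
    (PairMsg.support ((sampler n T).send r u ((sampler n T).run G ω r u) v)).card ≤ K := by
  obtain ⟨t, rfl | rfl⟩ := r.even_or_odd'
  · refine le_trans ?_ (h1 u v)
    have e : (sampler n T).send (2 * t) u ((sampler n T).run G ω (2 * t) u) v =
        fun x => sampleMsg G ω t (v - x) u x := by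
      have := (sampler_run G ω t).2 v
      rw [Protocol.run] at this
      have e1 : 2 * t % 2 = 0 := by omega
      simp only [sampler, e1, if_true] at this ⊢
      exact congrFun this u
    rw [e]
    refine Finset.card_le_card_of_injOn (fun x => (u, v - x)) (fun x hx => ?_)
      fun x _ y _ hxy => by simpa using hxy
    have := sampleMsg_ne G ω (by simpa [PairMsg.support] using hx)
    simp only [Finset.coe_filter, Set.mem_ofPred_eq, outLoad, Finset.mem_image]
    exact ⟨⟨x, by simpa using this.1, rfl⟩, this.2⟩
  · refine le_trans ?_ (h2 u v)
    have e : (sampler n T).send (2 * t + 1) u ((sampler n T).run G ω (2 * t + 1) u) v =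
        fun x => sampleMsg G ω t (u - v) x v := by
      have := (sampler_run G ω t).2 u
      generalize (sampler n T).run G ω (2 * t + 1) u = s at this
      have e1 : ¬(2 * t + 1) % 2 = 0 := by omega
      simp only [sampler, e1, if_false, this]
    rw [e]
    refine Finset.card_le_card_of_injOn (fun x => (x, u - v)) (fun x hx => ?_)
      fun x _ y _ hxy => by simpa using hxy
    have := sampleMsg_ne G ω (by simpa [PairMsg.support] using hx)
    simp only [Finset.coe_filter, Set.mem_ofPred_eq, inLoad, Finset.mem_image]
    exact ⟨⟨x, by simpa using this.1.symm, rfl⟩, this.2⟩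

end Sampler

/-! ### The main theorem -/

section Main

variable {n T : ℕ}

/-- The CongestedClique algorithm that executes the sampling protocol bit by bit. -/
def samplerAlg (n T L : ℕ) [NeZero n] (p : ℝ≥0) (hp : p ≤ 1) (fug : ℝ≥0)
    (enc : Option (PairMsg n) → ℕ → Bool) (dec : (ℕ → Bool) → Option (PairMsg n)) :
    CongestedCliqueAlg n 1 (Fin n → Bool) :=
  (sampler n T).bitwise (indep fun _ : Fin n => indep fun _ : Fin T => hardcoreProposal p hp fug)
    L enc dec

theorem le_toReal_of_load {K ℓ : ℕ} (hn : 0 < n) (hℓ : n ≤ 2 ^ ℓ) (hK : K = 2 * T + 4 * ℓ + 1)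
    (G : SimpleGraph (Fin n)) [DecidableRel G.Adj] (p : ℝ≥0) (hp : p ≤ 1) (fug : ℝ≥0)
    (hD : G.maxDegree * ((fug : ℝ) / (fug + 1)) ≤ 1)
    (E : Set (Fin n → Fin n → Fin T → Option Bool))
    (hE : ∀ ω, (∀ u w, load (outLoad G u w) ω ≤ K) → (∀ w v, load (inLoad G w v) ω ≤ K) → ω ∈ E) :
    1 - 1 / (n : ℝ) ^ 2 ≤ ((indep fun _ : Fin n => indep fun _ : Fin n => indep fun _ : Fin T =>
      hardcoreProposal p hp fug).toOuterMeasure E).toReal := by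
  classical
  rw [toReal_toOuterMeasure]
  set μ := indep fun _ : Fin n => indep fun _ : Fin n => indep fun _ : Fin T =>
      hardcoreProposal p hp fug
  have h1 : ∀ ω, 1 - ∑ u : Fin n, ∑ w : Fin n,
      ((if K < load (outLoad G u w) ω then (1 : ℝ) else 0) +
        (if K < load (inLoad G u w) ω then 1 else 0)) ≤ if ω ∈ E then 1 else 0 := by
    intro ω
    have h0 : ∀ u w : Fin n, (0 : ℝ) ≤ (if K < load (outLoad G u w) ω then (1 : ℝ) else 0) +
        (if K < load (inLoad G u w) ω then 1 else 0) := fun u w => by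
      split_ifs <;> norm_num
    split_ifs with h
    · exact sub_le_self _ (Finset.sum_nonneg fun u _ => Finset.sum_nonneg fun w _ => h0 u w)
    · obtain ⟨u, w, huw⟩ : ∃ u w, K < load (outLoad G u w) ω ∨ K < load (inLoad G u w) ω := by
        by_contra hne
        push Not at hne
        exact h (hE ω (fun u w => (hne u w).1) fun u w => (hne u w).2)
      have h2 : (1 : ℝ) ≤ (if K < load (outLoad G u w) ω then (1 : ℝ) else 0) +
          (if K < load (inLoad G u w) ω then 1 else 0) := by
        rcases huw with h | h <;> rw [if_pos h] <;> split_ifs <;> norm_num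
      have h3 := Finset.single_le_sum (fun w _ => h0 u w) (Finset.mem_univ w)
      have h4 := Finset.single_le_sum (f := fun u => ∑ w, ((if K < load (outLoad G u w) ω then
        (1 : ℝ) else 0) + (if K < load (inLoad G u w) ω then 1 else 0)))
        (fun u _ => Finset.sum_nonneg fun w _ => h0 u w) (Finset.mem_univ u)
      linarith
  refine le_trans ?_ (expect_mono μ h1)
  rw [expect_sub, expect_const, expect_sum]
  have hb : ∀ u w : Fin n, (expect μ fun ω =>
      (if K < load (outLoad G u w) ω then (1 : ℝ) else 0) +
        (if K < load (inLoad G u w) ω then 1 else 0)) ≤ 2 * (2 ^ (2 * T) / 2 ^ K) := by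
    intro u w
    rw [expect_add, two_mul]
    exact add_le_add (expect_lt_load_le p hp fug K _ hD _ (card_outLoad_le G u w))
      (expect_lt_load_le p hp fug K _ hD _ (card_inLoad_le G u w))
  have hsum : ∑ u : Fin n, (expect μ fun ω => ∑ w : Fin n,
      ((if K < load (outLoad G u w) ω then (1 : ℝ) else 0) +
        (if K < load (inLoad G u w) ω then 1 else 0))) ≤
      ∑ _u : Fin n, ∑ _w : Fin n, 2 * (2 ^ (2 * T) / 2 ^ K) :=
    Finset.sum_le_sum fun u _ => by
      rw [expect_sum]
      exact Finset.sum_le_sum fun w _ => hb u w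
  refine sub_le_sub_left (hsum.trans ?_) 1
  have hn' : (0 : ℝ) < n := by exact_mod_cast hn
  have hℓ' : (n : ℝ) ^ 4 ≤ 2 ^ (4 * ℓ) := by
    rw [mul_comm, pow_mul]
    gcongr
    exact_mod_cast hℓ
  -- In `K`, the term 2T cancels the exponential moment, 1 pays for the two kinds of load, and 4ℓ
  -- gives n⁻⁴ against n² links.
  have e : (2 : ℝ) * (2 ^ (2 * T) / 2 ^ K) = 1 / 2 ^ (4 * ℓ) := by
    rw [hK, pow_add, pow_add]
    field_simp
  simp only [e, Finset.sum_const, Finset.card_univ, Fintype.card_fin, nsmul_eq_mul]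
  rw [mul_one_div, mul_div_assoc', div_le_div_iff₀ (by positivity) (by positivity)]
  linarith

theorem clog_le_four_mul {x : ℝ} (hn : 2 ≤ n) (hx : Real.log n ≤ x) :
    (Nat.clog 2 n : ℝ) ≤ 4 * x := by
  have hlog2 := Real.log_two_gt_d9
  have h2 : Real.log 2 ≤ Real.log n := Real.log_le_log (by norm_num) (by exact_mod_cast hn)
  have h1 := Nat.pow_pred_clog_lt_self (b := 2) (by norm_num) (show 1 < n by omega)
  have hpos : 0 < Nat.clog 2 n := Nat.clog_pos (by norm_num) hn
  have h3 : Real.log ((2 : ℝ) ^ (Nat.clog 2 n).pred) ≤ Real.log n :=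
    Real.log_le_log (by positivity) (by exact_mod_cast h1.le)
  rw [Real.log_pow, Nat.pred_eq_sub_one, Nat.cast_sub hpos, Nat.cast_one] at h3
  nlinarith [Nat.cast_nonneg (α := ℝ) (Nat.clog 2 n)]

theorem pow_mul_le_of_log_le {δ q : ℝ} (hn : 0 < n) (hδ : 0 < δ) (hq0 : q ≤ 1)
    (hT : Real.log (n / δ) ≤ q * T) : (1 - q) ^ T * n ≤ δ := by
  have hn' : (0 : ℝ) < n := by exact_mod_cast hn
  have h1 : (1 - q) ^ T ≤ δ / n := by
    calc (1 - q) ^ T ≤ Real.exp (-q) ^ T := by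
          refine pow_le_pow_left₀ (by linarith) ?_ T
          linarith [Real.add_one_le_exp (-q)]
      _ = Real.exp (T * -q) := (Real.exp_nat_mul _ _).symm
      _ ≤ Real.exp (-Real.log (n / δ)) := Real.exp_le_exp.mpr (by linarith)
      _ = δ / n := by rw [Real.exp_neg, Real.exp_log (by positivity), inv_div]
  calc (1 - q) ^ T * n ≤ δ / n * n := by gcongr
    _ = δ := div_mul_cancel₀ _ hn'.ne'

end Main

end

theorem mainTheorem8 (α : ℝ) (hα0 : 0 ≤ α) (hα1 : α < 1) :
    ∃ (p : ℝ≥0) (hp : p ≤ 1) (C : ℝ) (k : ℕ), 0 < p ∧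
      ∀ (n : ℕ) (fug : ℝ≥0) (δ : ℝ), 2 ≤ n → 0 < δ → δ < 1 →
        ∃ (B T R : ℕ) (P : CongestedCliqueAlg n B (Fin n → Bool)),
          (B : ℝ) ≤ C * Real.log n ∧
          (T : ℝ) ≤ C * Real.log (n / δ) ∧
          1 ≤ R ∧ (R : ℝ) ≤ C * Real.log (n / δ) ^ k ∧
          ∀ (G : SimpleGraph (Fin n)) [DecidableRel G.Adj],
            2 ≤ G.maxDegree → (fug : ℝ) ≤ α / ((G.maxDegree : ℝ) - 1) →
              tvDist ((hardcoreMRF (Fin n) fug).law G p hp (fun _ => false) T)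
                (hardcore G fug) ≤ δ ∧
              ∃ S : (Fin n → P.Coins) → (i : Fin n) → (v : Fin n) → Bool,
                P.randomness.map S =
                  (indep fun _ : Fin n =>
                    (hardcoreMRF (Fin n) fug).law G p hp (fun _ => false) T) ∧
                (∀ ω v x, P.outputAfter G ω R v = some x → x = fun i => S ω i v) ∧
                1 - 1 / (n : ℝ) ^ 2 ≤
                  (P.randomness.toOuterMeasure
                    {ω | ∀ v, (P.outputAfter G ω R v).isSome = true}).toReal := by
  have hγ0 : 0 ≤ 2 * α / (1 + α) := by positivity
  have hγ1 : 2 * α / (1 + α) < 1 := by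
    rw [div_lt_one (by linarith)]
    linarith
  obtain ⟨p, hpα⟩ : ∃ p : ℝ≥0, (p : ℝ) = (1 - 2 * α / (1 + α)) / 2 :=
    ⟨⟨_, by linarith⟩, rfl⟩
  have hp0 : (0 : ℝ) < p := by linarith
  have hp1 : (p : ℝ) ≤ 1 := by linarith
  have hp : p ≤ 1 := by exact_mod_cast hp1
  -- Additive constants are absorbed through 1 ≤ 2x, valid for x = log(n/δ) ≥ log 2.
  set c₁ : ℝ := 1 / (p : ℝ) ^ 2 + 2 with hc₁
  have hc₁0 : 2 ≤ c₁ := le_add_of_nonneg_left (by positivity)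
  set c₂ : ℝ := 2 * c₁ + 18 with hc₂
  refine ⟨p, hp, c₁ + (10 * c₂ + 4) * (2 * c₁), 3, by exact_mod_cast hp0, ?_⟩
  intro n fug δ hn hδ0 hδ1
  have : NeZero n := ⟨by omega⟩
  have hn' : (2 : ℝ) ≤ n := by exact_mod_cast hn
  set x := Real.log (n / δ) with hx
  have hlogn : 1 / 2 ≤ Real.log n := by
    have := Real.log_two_gt_d9
    have h2 : Real.log 2 ≤ Real.log n := Real.log_le_log (by norm_num) hn'
    linarith
  have hnx : Real.log n ≤ x :=
    Real.log_le_log (by linarith) (le_div_self (by linarith) hδ0 hδ1.le)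
  have hx0 : 1 / 2 ≤ x := hlogn.trans hnx
  set T := ⌈x / (p : ℝ) ^ 2⌉₊ with hT
  have hT0 : 1 ≤ T := Nat.ceil_pos.mpr (by positivity)
  have hTle : (T : ℝ) ≤ c₁ * x := by
    have := (Nat.ceil_lt_add_one (show 0 ≤ x / (p : ℝ) ^ 2 by positivity)).le
    calc (T : ℝ) ≤ x / (p : ℝ) ^ 2 + 1 := this
      _ ≤ x / (p : ℝ) ^ 2 + 2 * x := by linarith
      _ = c₁ * x := by rw [hc₁]; ring
  set ℓ := Nat.clog 2 n with hℓ
  have hℓle : (ℓ : ℝ) ≤ 4 * x := clog_le_four_mul hn hnx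
  have hnℓ : n ≤ 2 ^ ℓ := Nat.le_pow_clog (by norm_num) n
  set K := 2 * T + 4 * ℓ + 1 with hK
  have hKle : (K : ℝ) ≤ c₂ * x := by
    rw [hK, hc₂]
    push_cast
    linarith
  -- The three extra bits give 8n ≥ 4n + 1. Neither `K` nor the code depends on the graph or its
  -- degree.
  obtain ⟨enc, dec, hcode⟩ := exists_isCode (n := n) (K := K) (l := ℓ + 3) (by
    rw [pow_add]
    omega)
  set L := K * (ℓ + 3) + 1 with hL
  have hLle : (L : ℝ) ≤ (10 * c₂ + 4) * x ^ 2 := by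
    have h1 : (ℓ : ℝ) + 3 ≤ 10 * x := by linarith
    have h2 : (K : ℝ) * (ℓ + 3) ≤ c₂ * x * (10 * x) :=
      mul_le_mul hKle h1 (by positivity) (by positivity)
    rw [hL]
    push_cast
    nlinarith
  -- Each transition takes two rounds of large messages, to and from the relays, of `L` one-bit
  -- rounds each.
  refine ⟨1, T, L * (2 * T), samplerAlg n T L p hp fug enc dec, ?_, ?_, ?_, ?_, ?_⟩
  · have : 0 ≤ (10 * c₂ + 4) * (2 * c₁) := by positivity
    push_cast
    nlinarith
  · have : 0 ≤ (10 * c₂ + 4) * (2 * c₁) := by positivity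
    nlinarith
  · exact Nat.mul_pos (by omega) (by omega)
  · push_cast
    calc (L : ℝ) * (2 * T) ≤ (10 * c₂ + 4) * x ^ 2 * (2 * (c₁ * x)) := by gcongr
      _ = (10 * c₂ + 4) * (2 * c₁) * x ^ 3 := by ring
      _ ≤ (c₁ + (10 * c₂ + 4) * (2 * c₁)) * x ^ 3 := by
        gcongr
        linarith
  intro G _ hΔ hfug
  have hp2 : (p : ℝ) ^ 2 ≤ 1 := pow_le_one₀ hp0.le hp1
  have hD : G.maxDegree * ((fug : ℝ) / (fug + 1)) ≤ 1 :=
    (degree_mul_fug_le hα0 hα1 (by exact_mod_cast hΔ) fug.coe_nonneg hfug).trans hγ1.le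
  refine ⟨?_, fun ω i => sample G ω T i, map_trajectory_indep G p hp fug T, ?_, ?_⟩
  · refine (tvDist_law_hardcore_le (by linarith) p hp fug
      (expect_hammingDist_update_le_of_fug hα0 hα1 p hp fug hpα hΔ hfug) T).trans ?_
    rw [Fintype.card_fin]
    refine pow_mul_le_of_log_le (by omega) hδ0 hp2 ?_
    rw [mul_comm, ← div_le_iff₀ (by positivity)]
    exact Nat.le_ceil _
  · intro ω v y hy
    obtain ⟨s, hs, rfl⟩ := Option.map_eq_some_iff.mp hy
    change Protocol.simulated _ _ _ _ _ _ _ _ _ = _ at hs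
    rw [(sampler n T).simulated_sound hcode (by omega) G ω _ v s hs]
    exact ((sampler_run G ω T).1 v).2.2
  · refine le_toReal_of_load (by omega) hnℓ hK G p hp fug hD _ fun ω h1 h2 v => ?_
    have h3 := (sampler n T).simulated_complete (μ := indep fun _ : Fin n => indep fun _ : Fin T =>
      hardcoreProposal p hp fug) hcode (by omega) G ω (2 * T)
        (fun r _ u v => card_support_send_le G ω K r h1 h2 u v) v
    change (((sampler n T).bitwise _ L enc dec).outputAfter G ω (L * (2 * T)) v).isSome = true
    rw [Protocol.bitwise_outputAfter, h3]
    rfl
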